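/- All graphs are finite and simple, and $[m]=\{0,\dots,m-1\}$. For a graph $F$ with $\kappa$ vertices and a graph $G$ with $n$ vertices, let $P(F,G)$ be the number of $\kappa$-subsets of $V(G)$ that induce a graph isomorphic to $F$ and, for $n\ge\kappa$, let $p(F,G)=P(F,G)/\binom n\kappa$; let $\lambda_F(n)$ be the maximum of $p(F,G)$ over all $n$-vertex graphs $G$, and let $\lambda_F=\lim_{n\to\infty}\lambda_F(n)$ be the inducibility constant of $F$. A sequence of bipartite graphs $G_i$ with orders tending to infinity and with parts $V_{i,0},V_{i,1}$ is balanced if $|V_{i,0}|/|V(G_i)|\to 1/2$, and it is $c$-quasirandom if, for every bipartite graph $H$ with parts $U_0,U_1$ and edge set $E(H)$, the probability that a uniformly random map $U_0\cup U_1\to V(G_i)$ sending $U_0$ to $V_{i,0}$ and $U_1$ to $V_{i,1}$ maps all edges of $H$ to edges of $G_i$ tends to $c^{|E(H)|}$. A type is a graph $\tau$ on $[q]$; a $\tau$-flag is a graph together with an embedding of $\tau$ as an induced subgraph, whose image consists of the labelled roots. Isomorphisms of $\tau$-flags preserve each root. Let $\mathcal F^\tau_s$ be the set of $s$-vertex $\tau$-flags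 up to isomorphism, and let $\mathcal F_N$ be the set of $N$-vertex graphs up to isomorphism. For a graph $G$ and an injection $f:[q]\to V(G)$ let $\tau_f$ be the graph on $[q]$ for which $f$ is an embedding into $G$ as an induced subgraph, and let $V^{s}_{G,f}$ be the vector, indexed by $A\in\mathcal F^{\tau_f}_s$, of the numbers of $(s-q)$-subsets $X\subseteq V(G)\setminus f([q])$ such that $X\cup f([q])$ induces in $(G,f)$ a flag isomorphic to $A$. A flag algebra certificate on $N\ge\kappa$ vertices for $\lambda_F\le u$ consists of a real positive semi-definite matrix $X^\tau$ indexed by $\mathcal F^\tau_{(N+q)/2}$ for every type $\tau$ on $[q]$ with $1\le q\le N-2$ and $q\equiv N \pmod 2$ (where $X^\tau\neq0$ for at most one type in each isomorphism class of types), and real slacks $c_H\ge 0$ for $H\in\mathcal F_N$, such that, uniformly over all graphs $G$ with $n$ vertices, $$\sum_{H\in\mathcal F_N}(u-p(F,H))P(H,G)=\sum_{\substack{1\le q\le N-2\\ q\equiv N\,(\mathrm{mod}\,2)}}\ \sum_{f:[q]\hookrightarrow V(G)}\bigl(V^{s}_{G,f}\bigr)^{T}X^{\tau_f}\,V^{s}_{G,f}+\sum_{H\in\mathcal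 F_N}c_H\,P(H,G)+O(n^{N-1}),\qquad s=\frac{N+q}2 .$$ **Theorem.** Let $F$ be the 4-cycle with a pendant edge, that is, the graph on $\{0,1,2,3,4\}$ with edges $01,12,23,30,04$. Then $$\lambda_F=\frac{5^6}{2^8\cdot 3^5}=\frac{15625}{62208}.$$ This value is attained by balanced bipartite $5/6$-quasirandom graphs: such sequences (with strictly increasing orders) exist, and $p(F,G_i)\to 5^6/(2^8\cdot 3^5)$ for every such sequence $(G_i)$. Moreover, there is a flag algebra certificate on $N=5$ vertices for $\lambda_F\le 5^6/(2^8\cdot 3^5)$ with the following properties. A) For the single-vertex type $1$, the zero eigenspace of $X^1$ has dimension $1$. B) For the cherry $\nu$ on $[3]$ with edges $01,02$, the zero eigenspace of $X^\nu$ has dimension $1$. C) For the type $\sigma$ on $[3]$ with no edges, the zero eigenspace of $X^\sigma$ contains no non-zero linear combination of those 4-vertex $\sigma$-flags in which the unlabelled vertex sends at most one edge to the roots. D) For the type $\mu$ on $[3]$ with the only edge $01$, the zero eigenspace of $X^\mu$ contains no non-zero linear combination of those 4-vertex $\mu$-flags in which the unlabelled vertex sends at most one edge to the roots. -/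

import Mathlib

open Filter Topology
open scoped Matrix

noncomputable section

/-! ### Induced densities and the inducibility problem -/

/-- The number of `κ`-subsets of the vertex set of `G` that induce a graph isomorphic to `F`. -/
def indCount {κ n : ℕ} (F : SimpleGraph (Fin κ)) (G : SimpleGraph (Fin n)) : ℕ :=
  Nat.card {X : Finset (Fin n) //
    X.card = κ ∧ Nonempty (F ≃g G.induce (X : Set (Fin n)))}

/-- The induced density of `F` in `G` (meaningful when `κ ≤ n`). -/
def indDensity {κ n : ℕ} (F : SimpleGraph (Fin κ)) (G : SimpleGraph (Fin n)) : ℝ :=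
  (indCount F G : ℝ) / (n.choose κ : ℝ)

/-- The maximum induced density of `F` over all graphs with `n` vertices (a supremum over a
finite non-empty family). -/
def maxIndDensity {κ : ℕ} (F : SimpleGraph (Fin κ)) (n : ℕ) : ℝ :=
  ⨆ G : SimpleGraph (Fin n), indDensity F G

/-- Isomorphism of graphs on `Fin m`. -/
def graphSetoid (m : ℕ) : Setoid (SimpleGraph (Fin m)) where
  r G H := Nonempty (G ≃g H)
  iseqv := ⟨fun _ => ⟨RelIso.refl _⟩, fun ⟨e⟩ => ⟨e.symm⟩, fun ⟨e⟩ ⟨e'⟩ => ⟨e.trans e'⟩⟩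

/-- Graphs of order `m` up to isomorphism; `H.out` is the chosen representative of `H`. -/
def GraphClass (m : ℕ) : Type := Quotient (graphSetoid m)

instance (m : ℕ) : Finite (GraphClass m) :=
  inferInstanceAs (Finite (Quotient (graphSetoid m)))

instance (m : ℕ) : Fintype (GraphClass m) := Fintype.ofFinite _

/-! ### Types and flags -/

/-- A `τ`-flag on the vertex set `V`: a graph together with an embedding (as an induced subgraph)
of the type `τ`, whose image is the set of the labelled roots. -/
structure GraphFlag {q : ℕ} (τ : SimpleGraph (Fin q)) (V : Type) where
  graph : SimpleGraph V
  root : τ ↪g graph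

namespace GraphFlag

variable {q : ℕ} {τ : SimpleGraph (Fin q)}

/-- Isomorphism of `τ`-flags: a graph isomorphism that preserves every labelled root. -/
def Iso {V W : Type} (A : GraphFlag τ V) (B : GraphFlag τ W) : Prop :=
  ∃ e : A.graph ≃g B.graph, ∀ i, e (A.root i) = B.root i

/-- The sub-flag of `A` induced by the roots together with the vertices in `X`. -/
def restrict {V : Type} (A : GraphFlag τ V) (X : Set V) : GraphFlag τ ↥(X ∪ Set.range A.root) where
  graph := A.graph.induce (X ∪ Set.range A.root)
  root :=
    { toFun := fun i => ⟨A.root i, Or.inr ⟨i, rfl⟩⟩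
      inj' := fun _ _ h => A.root.injective (congrArg Subtype.val h)
      map_rel_iff' := A.root.map_rel_iff' }

/-- The number of sets `X` of `s - q` unlabelled vertices of `B` such that `X` and the roots
induce a sub-flag isomorphic to `A`. -/
def count {s n : ℕ} (A : GraphFlag τ (Fin s)) (B : GraphFlag τ (Fin n)) : ℕ :=
  Nat.card {X : Finset (Fin n) // X.card = s - q ∧ (∀ i, B.root i ∉ X) ∧
    A.Iso (B.restrict (X : Set (Fin n)))}

/-- The number of edges that the unlabelled vertices of a flag send to the roots. -/
def rootEdges {s : ℕ} (A : GraphFlag τ (Fin s)) : ℕ :=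
  Nat.card {p : Fin s × Fin q // p.1 ∉ Set.range A.root ∧ A.graph.Adj p.1 (A.root p.2)}

instance (s : ℕ) : Finite (GraphFlag τ (Fin s)) := by
  refine Finite.of_injective
    (fun A : GraphFlag τ (Fin s) => ((A.graph, (A.root : Fin q → Fin s)) :
      SimpleGraph (Fin s) × (Fin q → Fin s))) ?_
  rintro ⟨G, f⟩ ⟨H, g⟩ h
  simp only [Prod.mk.injEq] at h
  obtain ⟨rfl, h2⟩ := h
  congr 1
  exact DFunLike.coe_injective h2

/-- The flag obtained from a graph `G` by labelling some vertices by an injection `f`; its type is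
the graph on `Fin q` that `f` pulls back from `G`. -/
def ofInjection {n : ℕ} (G : SimpleGraph (Fin n)) (f : Fin q ↪ Fin n) :
    GraphFlag (G.comap f) (Fin n) where
  graph := G
  root := SimpleGraph.Embedding.comap f G

end GraphFlag

/-- Isomorphism of `τ`-flags with `s` vertices. -/
def flagSetoid {q : ℕ} (τ : SimpleGraph (Fin q)) (s : ℕ) : Setoid (GraphFlag τ (Fin s)) where
  r A B := A.Iso B
  iseqv :=
    ⟨fun _ => ⟨RelIso.refl _, fun _ => rfl⟩,
      fun ⟨e, he⟩ => ⟨e.symm, fun i => by rw [← he i]; exact e.symm_apply_apply _⟩,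
      fun ⟨e, he⟩ ⟨e', he'⟩ => ⟨e.trans e', fun i => by
        rw [← he' i, ← he i]; rfl⟩⟩

/-- The `τ`-flags with `s` vertices up to isomorphism; `A.out` is the chosen representative. -/
def FlagClass {q : ℕ} (τ : SimpleGraph (Fin q)) (s : ℕ) : Type := Quotient (flagSetoid τ s)

instance {q : ℕ} (τ : SimpleGraph (Fin q)) (s : ℕ) : Finite (FlagClass τ s) :=
  inferInstanceAs (Finite (Quotient (flagSetoid τ s)))

instance {q : ℕ} (τ : SimpleGraph (Fin q)) (s : ℕ) : Fintype (FlagClass τ s) := Fintype.ofFinite _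

/-- The vector of the counts of all `s`-vertex `τ`-flags in the `τ`-flag `B`. -/
def flagVector {q n : ℕ} {τ : SimpleGraph (Fin q)} (s : ℕ) (B : GraphFlag τ (Fin n)) :
    FlagClass τ s → ℝ :=
  fun A => (GraphFlag.count (Quotient.out A) B : ℝ)

/-! ### Flag algebra certificates -/

/-- A flag algebra certificate on `N` vertices for the upper bound `u` on the inducibility constant
of `F`: for every type `τ` on `Fin q`, where `1 ≤ q ≤ N - 2` and `q + N` is even, a positive
semi-definite matrix indexed by the `τ`-flags with `(N + q) / 2` vertices (non-zero for at most one
type in every isomorphism class of types), and for every graph of order `N` a non-negative slack,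
satisfying the flag algebra identity up to an error term that is `O(n ^ (N - 1))` uniformly over
all graphs of order `n`. -/
structure FlagCertificate {κ : ℕ} (F : SimpleGraph (Fin κ)) (N : ℕ) (u : ℝ) where
  le_order : κ ≤ N
  /-- The matrices of the certificate. -/
  X : ∀ {q : ℕ} (τ : SimpleGraph (Fin q)),
    Matrix (FlagClass τ ((N + q) / 2)) (FlagClass τ ((N + q) / 2)) ℝ
  posSemidef : ∀ {q : ℕ} (τ : SimpleGraph (Fin q)),
    1 ≤ q → q + 2 ≤ N → Even (q + N) → (X τ).PosSemidef
  one_representative : ∀ {q : ℕ} (τ τ' : SimpleGraph (Fin q)),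
    1 ≤ q → q + 2 ≤ N → Even (q + N) → τ ≠ τ' → Nonempty (τ ≃g τ') → X τ = 0 ∨ X τ' = 0
  /-- The slack coefficients. -/
  slack : GraphClass N → ℝ
  slack_nonneg : ∀ H, 0 ≤ slack H
  identity : ∃ C : ℝ, ∀ (n : ℕ) (G : SimpleGraph (Fin n)),
    |(∑ H : GraphClass N, (u - indDensity F (Quotient.out H)) * (indCount (Quotient.out H) G : ℝ))
      - ((∑ q ∈ (Finset.Icc 1 (N - 2)).filter (fun q => Even (q + N)),
            ∑ f : Fin q ↪ Fin n,
              flagVector ((N + q) / 2) (GraphFlag.ofInjection G f) ⬝ᵥ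
                (X (G.comap f) *ᵥ flagVector ((N + q) / 2) (GraphFlag.ofInjection G f)))
          + ∑ H : GraphClass N, slack H * (indCount (Quotient.out H) G : ℝ))|
      ≤ C * (n : ℝ) ^ (N - 1)

/-- The dimension of the zero eigenspace of a square matrix. -/
def nullDim {ι : Type} [Fintype ι] (M : Matrix ι ι ℝ) : ℕ :=
  Module.finrank ℝ (LinearMap.ker M.mulVecLin)

/-- The zero eigenspace of `M` contains no non-zero linear combination of those flags whose
unlabelled vertices send at most one edge to the roots. -/
def NoSparseNullVector {q s : ℕ} {τ : SimpleGraph (Fin q)}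
    (M : Matrix (FlagClass τ s) (FlagClass τ s) ℝ) : Prop :=
  ∀ v : FlagClass τ s → ℝ, M *ᵥ v = 0 →
    (∀ A : FlagClass τ s, v A ≠ 0 → GraphFlag.rootEdges (Quotient.out A) ≤ 1) → v = 0

/-! ### Bipartite quasirandomness -/

/-- For a bipartite graph with parts `Fin k`, `Fin l` and edge set `E`, the probability that a
uniformly random map that sends `Fin k` to `V₀` and `Fin l` to the complement of `V₀` sends all
edges in `E` to edges of `G`. -/
def bipHomDensity {n : ℕ} (G : SimpleGraph (Fin n)) (V₀ : Finset (Fin n)) {k l : ℕ}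
    (E : Finset (Fin k × Fin l)) : ℝ :=
  (Nat.card {p : (Fin k → {x // x ∈ V₀}) × (Fin l → {x // x ∉ V₀}) //
      ∀ e ∈ E, G.Adj (p.1 e.1) (p.2 e.2)} : ℝ) /
    (Nat.card ((Fin k → {x // x ∈ V₀}) × (Fin l → {x // x ∉ V₀})) : ℝ)

/-- A sequence of graphs `G i` of orders `m i → ∞`, each bipartite with parts `V₀ i` and its
complement, is balanced (the parts are almost equal) and `c`-quasirandom. -/
structure IsBalancedQuasirandom (c : ℝ) (m : ℕ → ℕ) (G : ∀ i, SimpleGraph (Fin (m i)))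
    (V₀ : ∀ i, Finset (Fin (m i))) : Prop where
  growing : Tendsto m atTop atTop
  bipartite : ∀ i x y, (G i).Adj x y → (x ∈ V₀ i ↔ y ∉ V₀ i)
  balanced : Tendsto (fun i => ((V₀ i).card : ℝ) / (m i : ℝ)) atTop (𝓝 (1 / 2))
  density : ∀ (k l : ℕ) (E : Finset (Fin k × Fin l)),
    Tendsto (fun i => bipHomDensity (G i) (V₀ i) E) atTop (𝓝 (c ^ E.card))

/-! ### The graphs and types of the theorem -/

/-- The 4-cycle `0,1,2,3` with the pendant edge `04`. -/
def fourCyclePendant : SimpleGraph (Fin 5) :=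
  SimpleGraph.fromEdgeSet {s(0, 1), s(1, 2), s(2, 3), s(3, 0), s(0, 4)}

/-- The single-vertex type. -/
def typeOne : SimpleGraph (Fin 1) := ⊥

/-- The cherry with edges `01` and `02`. -/
def typeCherry : SimpleGraph (Fin 3) := SimpleGraph.fromEdgeSet {s(0, 1), s(0, 2)}

/-- The type with three vertices and no edges. -/
def typeEmpty : SimpleGraph (Fin 3) := ⊥

/-- The type with three vertices and the only edge `01`. -/
def typeEdge : SimpleGraph (Fin 3) := SimpleGraph.fromEdgeSet {s(0, 1)}

end

/-! Upper bound. Each matrix of the certificate is a non-negative combination of squares of integer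
vectors, indexed by a complete code of the flags. Evaluated on the flag counts at fixed roots, such
a form expands into a sum over pairs of sets of unlabelled vertices, that is, over 5-tuples of
vertices (`sum_quadratic_three`, `sum_quadratic_one`). All but `O(n ^ 4)` of these tuples are
injective, so the total is, up to that error, the sum over all embeddings of `Fin 5` of a weight
`flagPart` that depends only on the induced labelled graph. Grouping the embeddings by isomorphism
class (`sum_comap_embedding`) turns this into a combination of induced counts. The slack of a class
is defined as whatever is missing in the identity, so the one fact left to verify is that 5-vertex
graphs have non-negative slack: an integer inequality, decided by the kernel in `checkAdj_symAdj`.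

Lower bound. In a bipartite graph the copies of the 4-cycle with pendant edge are the copies of
`K_{2,3}` minus an edge, with the missing edge absent. In a balanced `c`-quasirandom graph their
density is `(5/8) * 6 * c^5 * (1 - c)`, which is largest at `c = 5/6`, where it equals the bound.
Such graphs are built explicitly as `layeredGraph`. Since the maximum density is non-increasing in
the order (`maxIndDensity_succ_le`), one sequence attaining the bound bounds every term from below,
and the limit follows.

Zero eigenspaces. A vector is in the kernel of a weighted sum of squares exactly when every one of
the linear forms vanishes on it (`weightMatrix_mulVec_eq_zero_iff`), so the four claims are small
linear systems in the eight code coordinates. For the single vertex and the cherry the solution line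
is spanned by the flag frequencies in the extremal graphs. -/

noncomputable section

/-! ### Counting induced subgraphs by embeddings -/

/-- Embeddings of `Fin κ` correspond to pairs of a `κ`-set and a permutation. -/
lemma bijective_perm_orderEmb (κ n : ℕ) :
    Function.Bijective (fun p : {X : Finset (Fin n) // X.card = κ} × Equiv.Perm (Fin κ) =>
      p.2.toEmbedding.trans (p.1.1.orderEmbOfFin p.1.2).toEmbedding) := by
  constructor
  · rintro ⟨⟨X, hX⟩, π⟩ ⟨⟨Y, hY⟩, ρ⟩ h
    have hrange : ∀ (Z : Finset (Fin n)) (hZ : Z.card = κ) (σ : Equiv.Perm (Fin κ)),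
        Set.range (σ.toEmbedding.trans (Z.orderEmbOfFin hZ).toEmbedding) = (Z : Set (Fin n)) := by
      intro Z hZ σ
      have := Z.range_orderEmbOfFin hZ
      rw [← this]
      exact σ.surjective.range_comp (Z.orderEmbOfFin hZ)
    have hXY : X = Y := by
      have h1 := hrange X hX π
      have h2 := hrange Y hY ρ
      simp only at h
      rw [h, h2] at h1
      exact_mod_cast h1.symm
    subst hXY
    simp only [Prod.mk.injEq, true_and]
    ext i
    have := DFunLike.congr_fun h i
    simpa using congrArg Fin.val ((X.orderEmbOfFin hX).injective this)
  · intro φ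
    have hc : (Finset.univ.map φ).card = κ := by simp
    have hmem : ∀ i, ∃ j, (Finset.univ.map φ).orderEmbOfFin hc j = φ i := by
      intro i
      have : φ i ∈ Set.range ((Finset.univ.map φ).orderEmbOfFin hc) := by
        rw [Finset.range_orderEmbOfFin]; simp
      exact this
    choose g hg using hmem
    have ginj : Function.Injective g := by
      intro a b hab
      apply φ.injective
      rw [← hg a, ← hg b, hab]
    refine ⟨⟨⟨Finset.univ.map φ, hc⟩, Equiv.ofBijective g (Finite.injective_iff_bijective.1 ginj)⟩, ?_⟩
    ext i
    simp [hg i]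

namespace GraphClass

/-- The isomorphism class of a graph. -/
def mk {κ : ℕ} (F : SimpleGraph (Fin κ)) : GraphClass κ := Quotient.mk (graphSetoid κ) F

/-- The chosen representative of an isomorphism class. -/
def rep {κ : ℕ} (H : GraphClass κ) : SimpleGraph (Fin κ) :=
  Quotient.out (s := graphSetoid κ) H

lemma mk_rep {κ : ℕ} (H : GraphClass κ) : mk H.rep = H := Quotient.out_eq (s := graphSetoid κ) H

lemma mk_eq_iff {κ : ℕ} {F K : SimpleGraph (Fin κ)} : mk F = mk K ↔ Nonempty (F ≃g K) :=
  Quotient.eq (r := graphSetoid κ)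

lemma nonempty_iso_rep_mk {κ : ℕ} (F : SimpleGraph (Fin κ)) : Nonempty ((mk F).rep ≃g F) :=
  Quotient.mk_out (s := graphSetoid κ) F

end GraphClass

/-- The isomorphism class of the subgraph of `G` induced by a set of `κ` vertices. -/
def inducedClass {κ n : ℕ} (G : SimpleGraph (Fin n)) (X : {X : Finset (Fin n) // X.card = κ}) :
    GraphClass κ :=
  GraphClass.mk (G.comap (X.1.orderEmbOfFin X.2))

/-- The subgraph induced by `X`, relabelled along the increasing enumeration of `X`. -/
def comapIsoInduce {κ n : ℕ} (G : SimpleGraph (Fin n)) (X : Finset (Fin n)) (hX : X.card = κ) :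
    G.comap (X.orderEmbOfFin hX) ≃g G.induce (X : Set (Fin n)) where
  toEquiv := (X.orderIsoOfFin hX).toEquiv
  map_rel_iff' := by intro a b; simp [SimpleGraph.comap_adj]

lemma inducedClass_eq_iff {κ n : ℕ} (G : SimpleGraph (Fin n))
    (X : {X : Finset (Fin n) // X.card = κ}) (F : SimpleGraph (Fin κ)) :
    inducedClass G X = GraphClass.mk F ↔
      Nonempty (F ≃g G.induce (X.1 : Set (Fin n))) := by
  unfold inducedClass
  rw [GraphClass.mk_eq_iff]
  constructor
  · rintro ⟨e⟩
    exact ⟨e.symm.trans (comapIsoInduce G X.1 X.2)⟩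
  · rintro ⟨e⟩
    exact ⟨(comapIsoInduce G X.1 X.2).trans e.symm⟩

open Classical in
lemma indCount_eq_card_filter {κ n : ℕ} (F : SimpleGraph (Fin κ)) (G : SimpleGraph (Fin n)) :
    indCount F G = (Finset.univ.filter fun X : {X : Finset (Fin n) // X.card = κ} =>
      inducedClass G X = GraphClass.mk F).card := by
  rw [indCount, ← Fintype.card_subtype, ← Nat.card_eq_fintype_card]
  refine Nat.card_congr ?_
  refine (Equiv.subtypeSubtypeEquivSubtypeInter
    (fun X : Finset (Fin n) => X.card = κ)
    (fun X => Nonempty (F ≃g G.induce (X : Set (Fin n))))).symm.trans ?_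
  exact Equiv.subtypeEquivRight fun X => (inducedClass_eq_iff G X F).symm

/-- The `κ`-sets are grouped by the class that they induce; each fibre has `indCount` elements. -/
lemma sum_inducedClass {κ n : ℕ} (G : SimpleGraph (Fin n)) (g : GraphClass κ → ℝ) :
    ∑ X : {X : Finset (Fin n) // X.card = κ}, g (inducedClass G X) =
      ∑ H : GraphClass κ, g H * (indCount H.rep G : ℝ) := by
  classical
  rw [← Finset.sum_fiberwise (s := Finset.univ) (g := fun X => inducedClass G X)]
  refine Finset.sum_congr rfl fun H _ => ?_
  rw [indCount_eq_card_filter, GraphClass.mk_rep,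
    Finset.sum_congr rfl (g := fun _ => g H) (fun X hX => by rw [(Finset.mem_filter.1 hX).2])]
  simp [mul_comm]

lemma sum_indCount_out {κ n : ℕ} (G : SimpleGraph (Fin n)) :
    ∑ H : GraphClass κ, (indCount H.rep G : ℝ) = (n.choose κ : ℝ) := by
  have h := sum_inducedClass (κ := κ) G (fun _ => 1)
  simp only [one_mul] at h
  rw [← h]
  simp

/-- Composition with the isomorphism permutes the relabellings, so symmetrized sums are invariants
of the isomorphism class. -/
lemma sum_perm_comap_of_iso {κ : ℕ} {K L : SimpleGraph (Fin κ)} (e : K ≃g L)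
    (w : SimpleGraph (Fin κ) → ℝ) :
    ∑ π : Equiv.Perm (Fin κ), w (K.comap π) = ∑ π : Equiv.Perm (Fin κ), w (L.comap π) := by
  refine Fintype.sum_equiv (Equiv.mulLeft e.toEquiv) _ _ fun π => ?_
  congr 1
  ext a b
  simp only [SimpleGraph.comap_adj, Equiv.coe_mulLeft, Equiv.Perm.coe_mul, Function.comp]
  exact e.map_adj_iff.symm

/-- Sums over the embeddings of `Fin κ` are combinations of the induced subgraph counts. -/
lemma sum_comap_embedding {κ n : ℕ} (G : SimpleGraph (Fin n)) (w : SimpleGraph (Fin κ) → ℝ) :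
    ∑ φ : Fin κ ↪ Fin n, w (G.comap φ) =
      ∑ H : GraphClass κ, (∑ π : Equiv.Perm (Fin κ), w (H.rep.comap π)) *
        (indCount H.rep G : ℝ) := by
  -- An embedding is an image set together with a permutation. For a fixed set, the sum over the
  -- permutations depends only on the class that it induces.
  rw [← sum_inducedClass G
    (fun H => ∑ π : Equiv.Perm (Fin κ), w (H.rep.comap π)),
    ← Fintype.sum_bijective _ (bijective_perm_orderEmb κ n) _ _ (fun _ => rfl),
    Fintype.sum_prod_type]
  refine Finset.sum_congr rfl fun X _ => ?_
  obtain ⟨e⟩ : Nonempty ((inducedClass G X).rep ≃g G.comap (X.1.orderEmbOfFin X.2)) :=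
    GraphClass.nonempty_iso_rep_mk (G.comap (X.1.orderEmbOfFin X.2))
  rw [sum_perm_comap_of_iso e]
  rfl

open Classical in
/-- The induced density of `F` in a graph of the same order. -/
lemma indDensity_same_order {κ : ℕ} (F K : SimpleGraph (Fin κ)) :
    indDensity F K = if Nonempty (F ≃g K) then 1 else 0 := by
  unfold indDensity indCount
  have huniv : ∀ X : Finset (Fin κ), X.card = κ ↔ X = Finset.univ := by
    intro X
    rw [← Finset.card_eq_iff_eq_univ, Fintype.card_fin]
  have hiff : Nonempty (F ≃g K.induce ((Finset.univ : Finset (Fin κ)) : Set (Fin κ))) ↔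
      Nonempty (F ≃g K) := by
    have e : K.induce ((Finset.univ : Finset (Fin κ)) : Set (Fin κ)) ≃g K :=
      { toEquiv := Equiv.subtypeUnivEquiv (by simp)
        map_rel_iff' := by intro a b; rfl }
    exact ⟨fun ⟨f⟩ => ⟨f.trans e⟩, fun ⟨f⟩ => ⟨f.trans e.symm⟩⟩
  split_ifs with h
  · have hcard : Nat.card {X : Finset (Fin κ) //
        X.card = κ ∧ Nonempty (F ≃g K.induce (X : Set (Fin κ)))} = 1 := by
      rw [Nat.card_eq_one_iff_unique]
      refine ⟨⟨fun X Y => Subtype.ext ?_⟩, ⟨Finset.univ, by simp, hiff.2 h⟩⟩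
      rw [(huniv _).1 X.2.1, (huniv _).1 Y.2.1]
    rw [hcard]; simp
  · have : IsEmpty {X : Finset (Fin κ) //
        X.card = κ ∧ Nonempty (F ≃g K.induce (X : Set (Fin κ)))} := by
      refine ⟨fun X => h (hiff.1 ?_)⟩
      have h2 := X.2.2
      rwa [(huniv _).1 X.2.1] at h2
    simp

lemma indCount_out_mk {κ n : ℕ} (F : SimpleGraph (Fin κ)) (G : SimpleGraph (Fin n)) :
    indCount (GraphClass.mk F).rep G = indCount F G := by
  classical
  rw [indCount_eq_card_filter, indCount_eq_card_filter, GraphClass.mk_rep]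

lemma sum_indDensity_mul_indCount {κ n : ℕ} (F : SimpleGraph (Fin κ)) (G : SimpleGraph (Fin n)) :
    ∑ H : GraphClass κ, indDensity F H.rep * (indCount H.rep G : ℝ) =
      indCount F G := by
  classical
  rw [Finset.sum_eq_single (GraphClass.mk F)]
  · rw [indCount_out_mk, indDensity_same_order, if_pos, one_mul]
    obtain ⟨e⟩ := GraphClass.nonempty_iso_rep_mk F
    exact ⟨e.symm⟩
  · intro H _ hH
    rw [indDensity_same_order, if_neg, zero_mul]
    rintro ⟨e⟩
    apply hH
    rw [← GraphClass.mk_rep H]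
    exact GraphClass.mk_eq_iff.2 ⟨e.symm⟩
  · simp

/-! ### Quadratic forms in flag counts -/

namespace GraphFlag

variable {q : ℕ} {τ : SimpleGraph (Fin q)}

lemma Iso.symm {V W : Type} {A : GraphFlag τ V} {B : GraphFlag τ W} (h : A.Iso B) : B.Iso A := by
  obtain ⟨e, he⟩ := h
  exact ⟨e.symm, fun i => by rw [← he i]; exact e.symm_apply_apply _⟩

lemma Iso.trans {V W U : Type} {A : GraphFlag τ V} {B : GraphFlag τ W} {C : GraphFlag τ U}
    (h : A.Iso B) (h' : B.Iso C) : A.Iso C := by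
  obtain ⟨e, he⟩ := h
  obtain ⟨e', he'⟩ := h'
  exact ⟨e.trans e', fun i => by rw [← he' i, ← he i]; rfl⟩

/-- The transport of a flag along a bijection of the vertex sets. -/
def transport {V W : Type} (A : GraphFlag τ V) (e : V ≃ W) : GraphFlag τ W where
  graph := A.graph.comap e.symm
  root :=
    { toFun := fun i => e (A.root i)
      inj' := fun _ _ h => A.root.injective (e.injective h)
      map_rel_iff' := by
        intro a b
        change A.graph.Adj (e.symm (e (A.root a))) (e.symm (e (A.root b))) ↔ _
        rw [e.symm_apply_apply, e.symm_apply_apply]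
        exact A.root.map_adj_iff }

lemma iso_transport {V W : Type} (A : GraphFlag τ V) (e : V ≃ W) : A.Iso (A.transport e) :=
  ⟨{ toEquiv := e, map_rel_iff' := by intro a b; simp [transport, SimpleGraph.comap_adj] },
    fun _ => rfl⟩

open Classical in
/-- The sets of `s - q` unlabelled vertices of a flag. -/
def freeSets {n : ℕ} (B : GraphFlag τ (Fin n)) (s : ℕ) : Finset (Finset (Fin n)) :=
  Finset.univ.filter fun X => X.card = s - q ∧ ∀ i, B.root i ∉ X

lemma mem_freeSets {n s : ℕ} {B : GraphFlag τ (Fin n)} {X : Finset (Fin n)} :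
    X ∈ B.freeSets s ↔ X.card = s - q ∧ ∀ i, B.root i ∉ X := by
  simp [freeSets]

lemma card_restrict {n s : ℕ} {B : GraphFlag τ (Fin n)} {X : Finset (Fin n)}
    (hX : X ∈ B.freeSets s) (hqs : q ≤ s) :
    Nat.card ↥((X : Set (Fin n)) ∪ Set.range B.root) = s := by
  rw [mem_freeSets] at hX
  rw [Nat.card_coe_set_eq, Set.ncard_union_eq]
  · rw [Set.ncard_coe_finset, hX.1, ← Nat.card_coe_set_eq,
      Nat.card_range_of_injective B.root.injective]
    simp [hqs]
  · rw [Set.disjoint_left]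
    rintro x hx ⟨i, rfl⟩
    exact hX.2 i hx

end GraphFlag

namespace FlagClass

variable {q s : ℕ} {τ : SimpleGraph (Fin q)}

/-- The isomorphism class of a flag. -/
def mk (A : GraphFlag τ (Fin s)) : FlagClass τ s := Quotient.mk (flagSetoid τ s) A

/-- The chosen representative of an isomorphism class of flags. -/
def rep (A : FlagClass τ s) : GraphFlag τ (Fin s) := Quotient.out (s := flagSetoid τ s) A

lemma mk_rep (A : FlagClass τ s) : mk A.rep = A := Quotient.out_eq (s := flagSetoid τ s) A

lemma mk_eq_iff {A B : GraphFlag τ (Fin s)} : mk A = mk B ↔ A.Iso B :=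
  Quotient.eq (r := flagSetoid τ s)

lemma rep_mk_iso (A : GraphFlag τ (Fin s)) : (mk A).rep.Iso A :=
  Quotient.mk_out (s := flagSetoid τ s) A

/-- The classes are represented on `Fin s`, so the sub-flag spanned by `X` is transported there;
`hqs` ensures that `X` and the roots together have exactly `s` vertices. -/
lemma exists_forall_iso_iff {n : ℕ} {B : GraphFlag τ (Fin n)} {X : Finset (Fin n)}
    (hX : X ∈ B.freeSets s) (hqs : q ≤ s) :
    ∃ A : FlagClass τ s, ∀ A' : FlagClass τ s,
      A'.rep.Iso (B.restrict (X : Set (Fin n))) ↔ A' = A := by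
  have e := Finite.equivFinOfCardEq (GraphFlag.card_restrict hX hqs)
  refine ⟨mk ((B.restrict (X : Set (Fin n))).transport e), fun A' => ?_⟩
  constructor
  · intro h
    rw [← mk_rep A', mk_eq_iff]
    exact h.trans (GraphFlag.iso_transport _ e)
  · rintro rfl
    exact (rep_mk_iso _).trans (GraphFlag.iso_transport _ e).symm

end FlagClass

section

variable {q s n : ℕ} {τ : SimpleGraph (Fin q)}

open Classical in
lemma flagVector_eq_sum (B : GraphFlag τ (Fin n)) (A : FlagClass τ s) :
    flagVector s B A = ∑ X ∈ B.freeSets s,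
      if A.rep.Iso (B.restrict (X : Set (Fin n))) then (1 : ℝ) else 0 := by
  rw [Finset.sum_boole]
  change (Nat.card {X : Finset (Fin n) // X.card = s - q ∧ (∀ i, B.root i ∉ X) ∧
    GraphFlag.Iso A.rep (B.restrict (X : Set (Fin n)))} : ℝ) = _
  rw [Nat.card_eq_fintype_card, Fintype.card_subtype]
  congr 2
  ext X
  simp [GraphFlag.mem_freeSets, and_assoc]

/-- Sums over flags, weighted by flag counts, are sums over sets of unlabelled vertices. -/
lemma sum_flagVector_mul (B : GraphFlag τ (Fin n)) (hqs : q ≤ s) (h : FlagClass τ s → ℝ)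
    (h' : Finset (Fin n) → ℝ)
    (hh : ∀ A X, X ∈ B.freeSets s → A.rep.Iso (B.restrict (X : Set (Fin n))) → h A = h' X) :
    ∑ A, flagVector s B A * h A = ∑ X ∈ B.freeSets s, h' X := by
  classical
  simp_rw [flagVector_eq_sum, Finset.sum_mul]
  rw [Finset.sum_comm]
  refine Finset.sum_congr rfl fun X hX => ?_
  -- Each free set realizes exactly one class, so a single term of the inner sum survives.
  obtain ⟨A, hA⟩ := FlagClass.exists_forall_iso_iff hX hqs
  simp_rw [hA]
  rw [Finset.sum_eq_single A]
  · simp [hh A X hX ((hA A).2 rfl)]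
  · intro A' _ hne
    simp [hne]
  · simp

/-- A product of two flag counts counts pairs `(X, Y)`, which may overlap. A form whose entries
depend only on an isomorphism-invariant code can therefore be read off the sub-flags themselves,
without choosing representatives. -/
lemma flagVector_quadratic {α : Type*} (B : GraphFlag τ (Fin n)) (hqs : q ≤ s)
    (Q : α → α → ℝ) (c : FlagClass τ s → α) (c' : Finset (Fin n) → α)
    (hc : ∀ A X, X ∈ B.freeSets s → A.rep.Iso (B.restrict (X : Set (Fin n))) → c A = c' X) :
    flagVector s B ⬝ᵥ (Matrix.of (fun A A' => Q (c A) (c A')) *ᵥ flagVector s B) =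
      ∑ X ∈ B.freeSets s, ∑ Y ∈ B.freeSets s, Q (c' X) (c' Y) := by
  simp only [dotProduct, Matrix.mulVec, Matrix.of_apply]
  refine sum_flagVector_mul B hqs _ _ fun A X hX hA => ?_
  simp_rw [mul_comm (Q _ _)]
  refine sum_flagVector_mul B hqs _ _ fun A' Y hY hA' => ?_
  rw [hc A X hX hA, hc A' Y hY hA']

end

/-! ### Codes of flags -/

namespace GraphFlag

open Classical in
/-- For a flag with three roots, the roots which have an unlabelled neighbour. -/
def attachCode {τ : SimpleGraph (Fin 3)} {V : Type} (A : GraphFlag τ V) : Bool × Bool × Bool :=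
  (decide (∃ v, v ∉ Set.range A.root ∧ A.graph.Adj v (A.root 0)),
    decide (∃ v, v ∉ Set.range A.root ∧ A.graph.Adj v (A.root 1)),
    decide (∃ v, v ∉ Set.range A.root ∧ A.graph.Adj v (A.root 2)))

open Classical in
/-- For a flag with one root: is there an unlabelled neighbour of the root, is there an unlabelled
non-neighbour of the root, is there an edge between unlabelled vertices? -/
def pairCode {τ : SimpleGraph (Fin 1)} {V : Type} (A : GraphFlag τ V) : Bool × Bool × Bool :=
  (decide (∃ v, v ∉ Set.range A.root ∧ A.graph.Adj v (A.root 0)),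
    decide (∃ v, v ∉ Set.range A.root ∧ ¬ A.graph.Adj v (A.root 0)),
    decide (∃ v, v ∉ Set.range A.root ∧ ∃ w, w ∉ Set.range A.root ∧ A.graph.Adj v w))

lemma Iso.exists_iff {q : ℕ} {τ : SimpleGraph (Fin q)} {V W : Type} {A : GraphFlag τ V}
    {B : GraphFlag τ W} {P : V → Prop} {Q : W → Prop} (e : A.graph ≃g B.graph)
    (he : ∀ i, e (A.root i) = B.root i) (hPQ : ∀ v, P v ↔ Q (e v)) :
    (∃ v, v ∉ Set.range A.root ∧ P v) ↔ ∃ w, w ∉ Set.range B.root ∧ Q w := by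
  have hr : ∀ v, v ∈ Set.range A.root ↔ e v ∈ Set.range B.root := by
    intro v
    simp only [Set.mem_range, ← he, e.injective.eq_iff]
  constructor
  · rintro ⟨v, hv, h⟩
    exact ⟨e v, fun h' => hv ((hr v).2 h'), (hPQ v).1 h⟩
  · rintro ⟨w, hw, h⟩
    obtain ⟨v, rfl⟩ := e.surjective w
    exact ⟨v, fun h' => hw ((hr v).1 h'), (hPQ v).2 h⟩

lemma Iso.attachCode_eq {τ : SimpleGraph (Fin 3)} {V W : Type} {A : GraphFlag τ V}
    {B : GraphFlag τ W} (h : A.Iso B) : A.attachCode = B.attachCode := by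
  obtain ⟨e, he⟩ := h
  have key : ∀ i, (∃ v, v ∉ Set.range A.root ∧ A.graph.Adj v (A.root i)) ↔
      ∃ w, w ∉ Set.range B.root ∧ B.graph.Adj w (B.root i) := fun i =>
    Iso.exists_iff e he fun v => by rw [← he]; exact e.map_adj_iff.symm
  exact Prod.ext (decide_eq_decide.2 (key 0))
    (Prod.ext (decide_eq_decide.2 (key 1)) (decide_eq_decide.2 (key 2)))

lemma Iso.pairCode_eq {τ : SimpleGraph (Fin 1)} {V W : Type} {A : GraphFlag τ V}
    {B : GraphFlag τ W} (h : A.Iso B) : A.pairCode = B.pairCode := by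
  obtain ⟨e, he⟩ := h
  have key : ∀ i v, A.graph.Adj v (A.root i) ↔ B.graph.Adj (e v) (B.root i) := fun i v => by
    rw [← he]; exact e.map_adj_iff.symm
  have h1 := Iso.exists_iff (P := fun v => A.graph.Adj v (A.root 0))
    (Q := fun v => B.graph.Adj v (B.root 0)) e he (key 0)
  have h2 := Iso.exists_iff (P := fun v => ¬ A.graph.Adj v (A.root 0))
    (Q := fun v => ¬ B.graph.Adj v (B.root 0)) e he (fun v => not_congr (key 0 v))
  have h3 := Iso.exists_iff (P := fun v => ∃ w, w ∉ Set.range A.root ∧ A.graph.Adj v w)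
    (Q := fun v => ∃ w, w ∉ Set.range B.root ∧ B.graph.Adj v w) e he
    (fun v => Iso.exists_iff (P := fun w => A.graph.Adj v w)
      (Q := fun w => B.graph.Adj (e v) w) e he fun w => e.map_adj_iff.symm)
  exact Prod.ext (decide_eq_decide.2 h1)
    (Prod.ext (decide_eq_decide.2 h2) (decide_eq_decide.2 h3))

lemma exists_restrict_iff {q : ℕ} {τ : SimpleGraph (Fin q)} {V : Type} (B : GraphFlag τ V)
    {X : Set V} (hX : ∀ i, B.root i ∉ X) (P : V → Prop) :
    (∃ v, v ∉ Set.range (B.restrict X).root ∧ P v.1) ↔ ∃ x ∈ X, P x := by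
  constructor
  · rintro ⟨⟨v, hv⟩, hv', h⟩
    rcases hv with hv | ⟨i, rfl⟩
    · exact ⟨v, hv, h⟩
    · exact absurd ⟨i, rfl⟩ hv'
  · rintro ⟨x, hx, h⟩
    refine ⟨⟨x, Or.inl hx⟩, ?_, h⟩
    rintro ⟨i, hi⟩
    apply hX i
    have : B.root i = x := congrArg Subtype.val hi
    rwa [this]

open Classical in
lemma attachCode_restrict {τ : SimpleGraph (Fin 3)} {V : Type} (B : GraphFlag τ V)
    {X : Set V} (hX : ∀ i, B.root i ∉ X) :
    (B.restrict X).attachCode = (decide (∃ x ∈ X, B.graph.Adj x (B.root 0)),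
      decide (∃ x ∈ X, B.graph.Adj x (B.root 1)), decide (∃ x ∈ X, B.graph.Adj x (B.root 2))) := by
  have key : ∀ i, (∃ v, v ∉ Set.range (B.restrict X).root ∧
      (B.restrict X).graph.Adj v ((B.restrict X).root i)) ↔ ∃ x ∈ X, B.graph.Adj x (B.root i) :=
    fun i => exists_restrict_iff B hX fun v => B.graph.Adj v (B.root i)
  simp only [attachCode, key]

open Classical in
lemma pairCode_restrict {τ : SimpleGraph (Fin 1)} {V : Type} (B : GraphFlag τ V)
    {X : Set V} (hX : ∀ i, B.root i ∉ X) :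
    (B.restrict X).pairCode = (decide (∃ x ∈ X, B.graph.Adj x (B.root 0)),
      decide (∃ x ∈ X, ¬ B.graph.Adj x (B.root 0)),
      decide (∃ x ∈ X, ∃ y ∈ X, B.graph.Adj x y)) := by
  have h1 : (∃ v, v ∉ Set.range (B.restrict X).root ∧
      (B.restrict X).graph.Adj v ((B.restrict X).root 0)) ↔ ∃ x ∈ X, B.graph.Adj x (B.root 0) :=
    exists_restrict_iff B hX fun v => B.graph.Adj v (B.root 0)
  have h2 : (∃ v, v ∉ Set.range (B.restrict X).root ∧
      ¬ (B.restrict X).graph.Adj v ((B.restrict X).root 0)) ↔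
      ∃ x ∈ X, ¬ B.graph.Adj x (B.root 0) :=
    exists_restrict_iff B hX fun v => ¬ B.graph.Adj v (B.root 0)
  have h3 : (∃ v, v ∉ Set.range (B.restrict X).root ∧ ∃ w, w ∉ Set.range (B.restrict X).root ∧
      (B.restrict X).graph.Adj v w) ↔ ∃ x ∈ X, ∃ y ∈ X, B.graph.Adj x y := by
    rw [← exists_restrict_iff B hX fun v => ∃ y ∈ X, B.graph.Adj v y]
    refine exists_congr fun v => and_congr_right fun _ => ?_
    exact exists_restrict_iff B hX fun w => B.graph.Adj v.1 w
  simp only [pairCode, h1, h2, h3]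

lemma sum_freeSets_four {τ : SimpleGraph (Fin 3)} {n : ℕ} (B : GraphFlag τ (Fin n))
    (h : Finset (Fin n) → ℝ) :
    ∑ X ∈ B.freeSets 4, h X = ∑ x ∈ (Finset.univ.map B.root.toEmbedding)ᶜ, h {x} := by
  refine Eq.trans (Finset.sum_congr ?_ fun _ _ => rfl) (Finset.sum_map _
    ⟨fun x : Fin n => ({x} : Finset (Fin n)), Finset.singleton_injective⟩ h)
  ext X
  simp only [mem_freeSets, Finset.mem_map, Finset.mem_compl, Finset.mem_univ, true_and,
    Function.Embedding.coeFn_mk, Nat.reduceSub, Finset.card_eq_one]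
  constructor
  · rintro ⟨⟨x, rfl⟩, h⟩
    refine ⟨x, ?_, rfl⟩
    rintro ⟨i, hi⟩
    exact h i (by simpa using hi)
  · rintro ⟨x, hx, rfl⟩
    refine ⟨⟨x, rfl⟩, fun i hi => hx ⟨i, by simpa using hi⟩⟩

/-- Every two-element set arises from two ordered pairs, hence the division by 2. -/
lemma sum_freeSets_three {τ : SimpleGraph (Fin 1)} {n : ℕ} (B : GraphFlag τ (Fin n))
    (h : Finset (Fin n) → ℝ) :
    ∑ X ∈ B.freeSets 3, h X =
      (∑ p ∈ (Finset.univ.erase (B.root 0)).offDiag, h {p.1, p.2}) / 2 := by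
  classical
  have hmaps : ∀ p ∈ (Finset.univ.erase (B.root 0)).offDiag,
      ({p.1, p.2} : Finset (Fin n)) ∈ B.freeSets 3 := by
    rintro ⟨x, y⟩ hp
    simp only [Finset.mem_offDiag, Finset.mem_erase, Finset.mem_univ, and_true] at hp
    rw [mem_freeSets]
    refine ⟨Finset.card_pair hp.2.2, fun i => ?_⟩
    rw [Subsingleton.elim i 0]
    simp [hp.1.symm, hp.2.1.symm]
  rw [← Finset.sum_fiberwise_of_maps_to hmaps, Finset.sum_div]
  refine Finset.sum_congr rfl fun X hX => ?_
  rw [mem_freeSets] at hX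
  obtain ⟨x, y, hxy, rfl⟩ := Finset.card_eq_two.1 hX.1
  have hr := hX.2 0
  simp only [Finset.mem_insert, Finset.mem_singleton, not_or] at hr
  have hfib : ((Finset.univ.erase (B.root 0)).offDiag.filter
      fun p : Fin n × Fin n => ({p.1, p.2} : Finset (Fin n)) = {x, y}) = {(x, y), (y, x)} := by
    ext ⟨a, b⟩
    simp only [Finset.mem_filter, Finset.mem_offDiag, Finset.mem_erase, Finset.mem_univ, and_true,
      Finset.mem_insert, Finset.mem_singleton, Prod.mk.injEq]
    constructor
    · rintro ⟨⟨_, _, hab⟩, h⟩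
      have ha : a ∈ ({x, y} : Finset (Fin n)) := h ▸ by simp
      have hb : b ∈ ({x, y} : Finset (Fin n)) := h ▸ by simp
      simp only [Finset.mem_insert, Finset.mem_singleton] at ha hb
      grind
    · rintro (⟨rfl, rfl⟩ | ⟨rfl, rfl⟩)
      · exact ⟨⟨Ne.symm hr.1, Ne.symm hr.2, hxy⟩, rfl⟩
      · exact ⟨⟨Ne.symm hr.2, Ne.symm hr.1, Ne.symm hxy⟩, Finset.pair_comm _ _⟩
  rw [hfib, Finset.sum_pair (by simp [hxy])]
  simp only [Finset.pair_comm y x]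
  ring

end GraphFlag

/-! ### The data of the certificate -/

/-- Weighted vectors whose squares add up to the matrix of the single-vertex type. -/
def certOne : List (ℕ × List ℤ) := [
  (62674369360751383447149, [0, -52, 10, -26, 0, 52, 13, 26]),
  (6584286939492044463159206, [0, -2, 0, 5, 0, 0, -10, 1]),
  (37684623945032464484038500, [0, -2, 0, 0, 0, 0, 0, 1]),
  (3131403556620376353526, [0, 195, -145, 0, 0, 0, 78, 0]),
  (5461539702178618041165, [0, 0, -10, 0, 0, 0, 39, 0])]

/-- Weighted vectors whose squares add up to the matrix of the cherry. -/
def certCherry : List (ℕ × List ℤ) := [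
  (24030774689585919381126000, [-5, 5, -4, 0, -4, 0, -3, 0]),
  (172824415177522617673164, [25, 0, -35, 28, -35, 28, 7, -21]),
  (497000112898254241746015, [-40, 0, -7, 0, -7, 0, 14, 28]),
  (469303263336100929251880, [-65, 0, -42, 0, -42, 0, 35, 0]),
  (1256154131501082149467950, [-10, 0, 7, 0, 7, 0, 0, 0]),
  (2089792735201613669020849601, [0, 0, 1, 0, -1, 0, 0, 0]),
  (491538573196075623704850000, [0, 0, 0, 1, 0, -1, 0, 0])]

/-- Weighted vectors whose squares add up to the matrix of the type with three vertices and no edges. -/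
def certEmpty : List (ℕ × List ℤ) := [
  (5798686541026614429506, [-95, 231, 231, -343, 231, -343, -343, 343]),
  (2745842229450921211624, [-15, -28, -28, 49, -28, 49, 49, 0]),
  (1037692543413937427821350, [0, 2, -1, 1, -1, 1, -2, 0]),
  (1037692543413937427821350, [0, -1, 2, 1, -1, -2, 1, 0]),
  (1037692543413937427821350, [0, -1, -1, -2, 2, 1, 1, 0])]

/-- Weighted vectors whose squares add up to the matrix of the type with three vertices and one edge. -/
def certEdge : List (ℕ × List ℤ) := [
  (7379898925916846452452147, [-5, 0, 0, 6, -3, 2, 2, 3]),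
  (583604640434050685011926, [-45, 28, 28, 0, 42, -35, -35, 28]),
  (7100001612832203453514500, [0, 5, 5, 0, 0, -7, -7, -1]),
  (10923079404357236082330, [-25, 0, 0, 0, 0, 7, 7, 28]),
  (71000016128322034535145000, [0, 0, 0, 0, 0, 0, 0, 1]),
  (302120597449148363615567747, [0, 1, -1, 0, 0, 1, -1, 0])]

/-- The weighted vectors of the type with three vertices and given adjacencies `01`, `02`, `12`. -/
def certThree : Bool → Bool → Bool → List (ℕ × List ℤ)
  | true, true, false => certCherry
  | false, false, false => certEmpty
  | true, false, false => certEdge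
  | _, _, _ => []

/-- The common denominator of the matrices. -/
def certDen : ℕ := 33975146179312747110479232000

/-- The position of a code in the lists of vector entries. -/
def codeIndex (c : Bool × Bool × Bool) : ℕ := c.1.toNat + 2 * c.2.1.toNat + 4 * c.2.2.toNat

/-- The bilinear form given by a list of weighted vectors. -/
def weightForm (L : List (ℕ × List ℤ)) (a b : Bool × Bool × Bool) : ℤ :=
  (L.map fun p => (p.1 : ℤ) * (p.2.getD (codeIndex a) 0 * p.2.getD (codeIndex b) 0)).sum

/-- The contribution of the single-vertex type to a labelled graph on five vertices. -/
def rootPart (a : Fin 5 → Fin 5 → Bool) : ℤ :=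
  weightForm certOne (a 1 0 || a 2 0, !a 1 0 || !a 2 0, a 1 2)
    (a 3 0 || a 4 0, !a 3 0 || !a 4 0, a 3 4)

/-- The contribution of the types with three vertices to a labelled graph on five vertices. -/
def triplePart (a : Fin 5 → Fin 5 → Bool) : ℤ :=
  weightForm (certThree (a 0 1) (a 0 2) (a 1 2)) (a 3 0, a 3 1, a 3 2) (a 4 0, a 4 1, a 4 2)

/-- Is this the adjacency function of the 4-cycle with the pendant edge? -/
def isFourCyclePendant (a : Fin 5 → Fin 5 → Bool) : Bool :=
  a 0 1 && a 1 2 && a 2 3 && a 0 3 && a 0 4 && !a 0 2 && !a 1 3 && !a 1 4 && !a 2 4 && !a 3 4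

/-- The quantity whose symmetrization is bounded by the certificate. -/
def score (a : Fin 5 → Fin 5 → Bool) : ℤ :=
  rootPart a + 4 * triplePart a + if isFourCyclePendant a then 2 * (certDen : ℤ) else 0

/-- Evaluation of a function at a Boolean that is computed first. -/
def withBool {α : Type} (b : Bool) (f : Bool → α) : α :=
  match b with
  | true => f true
  | false => f false

lemma withBool_eq {α : Type} (b : Bool) (f : Bool → α) : withBool b f = f b := by
  cases b <;> rfl

/-- The symmetric adjacency function with the given values. -/
def symAdj (a01 a02 a03 a04 a12 a13 a14 a23 a24 a34 : Bool) : Fin 5 → Fin 5 → Bool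
  | 0, 1 => a01 | 0, 2 => a02 | 0, 3 => a03 | 0, 4 => a04 | 1, 2 => a12
  | 1, 3 => a13 | 1, 4 => a14 | 2, 3 => a23 | 2, 4 => a24 | 3, 4 => a34
  | 1, 0 => a01 | 2, 0 => a02 | 3, 0 => a03 | 4, 0 => a04 | 2, 1 => a12
  | 3, 1 => a13 | 4, 1 => a14 | 3, 2 => a23 | 4, 2 => a24 | 4, 3 => a34
  | _, _ => false

/-- The score, computed after all adjacencies. -/
def evalScore (a : Fin 5 → Fin 5 → Bool) : ℤ :=
  withBool (a 0 1) fun a01 => withBool (a 0 2) fun a02 => withBool (a 0 3) fun a03 =>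
  withBool (a 0 4) fun a04 => withBool (a 1 2) fun a12 => withBool (a 1 3) fun a13 =>
  withBool (a 1 4) fun a14 => withBool (a 2 3) fun a23 => withBool (a 2 4) fun a24 =>
  withBool (a 3 4) fun a34 => score (symAdj a01 a02 a03 a04 a12 a13 a14 a23 a24 a34)

/-- The relabelling of an adjacency function by a list of vertices. -/
def relabel (a : Fin 5 → Fin 5 → Bool) (l : List (Fin 5)) (i j : Fin 5) : Bool :=
  a (l.getD i 0) (l.getD j 0)

/-- The sum of the scores of all relabellings. -/
def symScore (a : Fin 5 → Fin 5 → Bool) : ℤ :=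
  ((List.permutations' [0, 1, 2, 3, 4]).map fun l => evalScore (relabel a l)).sum

/-- The adjacencies read as binary digits. -/
def adjRank (a : Fin 5 → Fin 5 → Bool) : ℕ :=
  [a 0 1, a 0 2, a 0 3, a 0 4, a 1 2, a 1 3, a 1 4, a 2 3, a 2 4, a 3 4].foldl
    (fun n b => 2 * n + b.toNat) 0

/-- The transpositions of `Fin 5`. -/
def swapLists : List (List (Fin 5)) :=
  [[1, 0, 2, 3, 4], [2, 1, 0, 3, 4], [3, 1, 2, 0, 4], [4, 1, 2, 3, 0], [0, 2, 1, 3, 4],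
    [0, 3, 2, 1, 4], [0, 4, 2, 3, 1], [0, 1, 3, 2, 4], [0, 1, 4, 3, 2], [0, 1, 2, 4, 3]]

/-- The finite check for one graph: unless some transposition decreases the rank, the
symmetrized score is bounded. -/
def checkAdj (a : Fin 5 → Fin 5 → Bool) : Bool :=
  swapLists.any (fun l => Nat.blt (adjRank (relabel a l)) (adjRank a)) ||
    decide (symScore a * 15552 ≤ 15625 * (certDen : ℤ))

-- The finite core of the upper bound: 1024 adjacency patterns. The first alternative of `checkAdj`
-- spares the sum over 120 relabellings unless the pattern cannot be lowered by a transposition.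
set_option maxRecDepth 100000 in
lemma checkAdj_symAdj : ∀ a01 a02 a03 a04 a12 a13 a14 a23 a24 a34 : Bool,
    checkAdj (symAdj a01 a02 a03 a04 a12 a13 a14 a23 a24 a34) = true := by
  decide +kernel

/-! ### The bound for the symmetrized score -/

open Classical in
/-- The Boolean adjacency function of a graph. -/
def boolAdj {V : Type} (K : SimpleGraph V) (x y : V) : Bool := decide (K.Adj x y)

lemma boolAdj_comm {V : Type} (K : SimpleGraph V) (x y : V) : boolAdj K x y = boolAdj K y x := by
  simp [boolAdj, K.adj_comm]

lemma boolAdj_self {V : Type} (K : SimpleGraph V) (x : V) : boolAdj K x x = false := by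
  simp [boolAdj]

lemma boolAdj_eq_symAdj (K : SimpleGraph (Fin 5)) :
    boolAdj K = symAdj (boolAdj K 0 1) (boolAdj K 0 2) (boolAdj K 0 3) (boolAdj K 0 4)
      (boolAdj K 1 2) (boolAdj K 1 3) (boolAdj K 1 4) (boolAdj K 2 3) (boolAdj K 2 4)
      (boolAdj K 3 4) := by
  funext i j
  fin_cases i <;> fin_cases j <;> first | rfl | exact boolAdj_self K _ | exact boolAdj_comm K _ _

lemma evalScore_boolAdj (K : SimpleGraph (Fin 5)) :
    evalScore (boolAdj K) = score (boolAdj K) := by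
  simp only [evalScore, withBool_eq]
  rw [← boolAdj_eq_symAdj]

/-- Replaces the sum over permutations by a sum over an explicit list that the kernel can run
through. The permutations inject into the list, and both have 120 elements. The default value of
`getD` is never used, as all lists have length five. -/
lemma sum_perm_eq_list_sum (f : (Fin 5 → Fin 5) → ℤ) :
    ∑ π : Equiv.Perm (Fin 5), f π =
      ((List.permutations' [0, 1, 2, 3, 4]).map fun l : List (Fin 5) =>
        f fun i => l.getD i 0).sum := by
  have hnd : (List.permutations' ([0, 1, 2, 3, 4] : List (Fin 5))).Nodup := by
    decide +kernel
  have himage : (Finset.univ.image fun π : Equiv.Perm (Fin 5) => List.ofFn π) =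
      (List.permutations' ([0, 1, 2, 3, 4] : List (Fin 5))).toFinset := by
    apply Finset.eq_of_subset_of_card_le
    · intro l hl
      obtain ⟨π, _, rfl⟩ := Finset.mem_image.1 hl
      rw [List.mem_toFinset, List.mem_permutations']
      exact Equiv.Perm.ofFn_comp_perm π (fun i => i)
    · rw [Finset.card_image_of_injective _
        (fun π ρ h => DFunLike.coe_injective (List.ofFn_injective h)),
        List.toFinset_card_of_nodup hnd, Finset.card_univ, Fintype.card_perm, Fintype.card_fin]
      decide +kernel
  rw [← List.sum_toFinset _ hnd, ← himage, Finset.sum_image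
    (fun π _ ρ _ h => DFunLike.coe_injective (List.ofFn_injective h))]
  refine Finset.sum_congr rfl fun π _ => ?_
  congr 1
  funext i
  fin_cases i <;> simp

lemma symScore_boolAdj (K : SimpleGraph (Fin 5)) :
    symScore (boolAdj K) = ∑ π : Equiv.Perm (Fin 5), score (boolAdj (K.comap π)) := by
  rw [sum_perm_eq_list_sum fun g => score (boolAdj (K.comap g)), symScore]
  congr 2
  funext l
  exact evalScore_boolAdj (K.comap fun i : Fin 5 => l.getD i 0)

lemma exists_perm_of_mem_swapLists {l : List (Fin 5)} (hl : l ∈ swapLists) :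
    ∃ π : Equiv.Perm (Fin 5), ∀ i : Fin 5, π i = l.getD i 0 := by
  have h : ∀ l ∈ swapLists, Function.Injective fun i : Fin 5 => l.getD i 0 := by decide +kernel
  exact ⟨Equiv.ofBijective _ (Finite.injective_iff_bijective.1 (h l hl)), fun _ => rfl⟩

/-- The bound for the score, summed over all relabellings of a graph. -/
lemma sum_score_le (K : SimpleGraph (Fin 5)) :
    ∑ π : Equiv.Perm (Fin 5), (score (boolAdj (K.comap π)) : ℝ) ≤
      4 * certDen * (15625 / 62208) := by
  -- The symmetrized score is the same for all relabellings, so one of minimal rank may be taken;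
  -- there the first alternative of the check is impossible.
  obtain ⟨σ, hσ⟩ := Finite.exists_min
    fun π : Equiv.Perm (Fin 5) => adjRank (boolAdj (K.comap π))
  have e : K.comap σ ≃g K := { toEquiv := σ, map_rel_iff' := Iff.rfl }
  rw [← sum_perm_comap_of_iso e fun K => (score (boolAdj K) : ℝ)]
  have hcheck : checkAdj (boolAdj (K.comap σ)) = true := by
    rw [boolAdj_eq_symAdj]
    exact checkAdj_symAdj _ _ _ _ _ _ _ _ _ _
  rw [checkAdj, Bool.or_eq_true] at hcheck
  rcases hcheck with h | h
  · exfalso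
    rw [List.any_eq_true] at h
    obtain ⟨l, hl, hlt⟩ := h
    obtain ⟨π, hπ⟩ := exists_perm_of_mem_swapLists hl
    have hr : relabel (boolAdj (K.comap σ)) l = boolAdj (K.comap (σ * π)) := by
      funext i j
      simp only [relabel, ← hπ]
      rfl
    rw [hr, Nat.blt_eq] at hlt
    exact absurd (hσ (σ * π)) (not_le.2 hlt)
  -- The factor 15552 is 62208 / 4, the 4 coming from the scaling of `score`.
  · rw [decide_eq_true_eq, symScore_boolAdj] at h
    have h2 : ((∑ π : Equiv.Perm (Fin 5), score (boolAdj ((K.comap σ).comap π)) : ℤ) : ℝ) * 15552 ≤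
        15625 * certDen := by exact_mod_cast h
    push_cast at h2
    linarith

open Classical in
lemma isFourCyclePendant_boolAdj (K : SimpleGraph (Fin 5)) :
    isFourCyclePendant (boolAdj K) = decide (K = fourCyclePendant) := by
  rw [Bool.eq_iff_iff, decide_eq_true_eq]
  constructor
  · intro h
    simp only [isFourCyclePendant, boolAdj, Bool.and_eq_true, decide_eq_true_eq,
      Bool.not_eq_true', decide_eq_false_iff_not] at h
    have hs := K.adj_comm
    ext i j
    fin_cases i <;> fin_cases j <;> simp [fourCyclePendant] <;> grind
  · rintro rfl
    simp [isFourCyclePendant, boolAdj, fourCyclePendant]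

lemma boolAdj_fourCyclePendant : boolAdj fourCyclePendant =
    symAdj true false true true true false false true false false := by
  rw [boolAdj_eq_symAdj]
  simp [boolAdj, fourCyclePendant]

-- The only non-trivial automorphism exchanges the vertices 1 and 3.
open Classical in
lemma card_aut_fourCyclePendant :
    (Finset.univ.filter fun π : Equiv.Perm (Fin 5) =>
      fourCyclePendant.comap π = fourCyclePendant).card = 2 := by
  have h : ∀ π : Equiv.Perm (Fin 5), fourCyclePendant.comap π = fourCyclePendant ↔
      isFourCyclePendant (fun i j => symAdj true false true true true false false true false false
        (π i) (π j)) = true := by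
    intro π
    rw [← boolAdj_fourCyclePendant]
    have := isFourCyclePendant_boolAdj (fourCyclePendant.comap π)
    rw [Bool.eq_iff_iff, decide_eq_true_eq] at this
    exact this.symm
  simp_rw [h]
  have key : (Finset.univ.filter fun π : Equiv.Perm (Fin 5) =>
      isFourCyclePendant (fun i j => symAdj true false true true true false false true false false
        (π i) (π j)) = true).card = 2 := by
    decide +kernel
  convert key

open Classical in
/-- The number of labelled copies in a graph of the same order. -/
lemma sum_perm_eq_fourCyclePendant (K : SimpleGraph (Fin 5)) :
    ∑ π : Equiv.Perm (Fin 5), (if K.comap π = fourCyclePendant then (1 : ℝ) else 0) =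
      2 * indDensity fourCyclePendant K := by
  rw [indDensity_same_order]
  split_ifs with h
  · obtain ⟨e⟩ := h
    rw [← sum_perm_comap_of_iso e fun K => if K = fourCyclePendant then (1 : ℝ) else 0,
      Finset.sum_boole, card_aut_fourCyclePendant]
    norm_num
  · rw [mul_zero]
    refine Finset.sum_eq_zero fun π _ => if_neg fun hπ => h ⟨?_⟩
    rw [← hπ]
    exact { toEquiv := π, map_rel_iff' := Iff.rfl }

/-- The contribution of all types to a labelled graph on five vertices. -/
def flagPart (K : SimpleGraph (Fin 5)) : ℝ :=
  ((rootPart (boolAdj K) : ℝ) / 4 + triplePart (boolAdj K)) / certDen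

lemma certDen_pos : (0 : ℝ) < certDen := by
  norm_num [certDen]

/-- The slack of the certificate is non-negative. -/
lemma slack_nonneg (K : SimpleGraph (Fin 5)) :
    0 ≤ 15625 / 62208 - indDensity fourCyclePendant K -
      ∑ π : Equiv.Perm (Fin 5), flagPart (K.comap π) := by
  classical
  have h := sum_score_le K
  -- `score` is scaled by `4 * certDen` to be an integer. Each copy contributes `2 * certDen` for
  -- each of its two labellings, so the density also receives the factor `4 * certDen`.
  have hs : ∀ L : SimpleGraph (Fin 5), (score (boolAdj L) : ℝ) =
      4 * certDen * flagPart L + 2 * certDen * (if L = fourCyclePendant then (1 : ℝ) else 0) := by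
    intro L
    have hD := certDen_pos.ne'
    rw [score, isFourCyclePendant_boolAdj, flagPart]
    by_cases hL : L = fourCyclePendant
    · simp only [hL, decide_true, if_true]
      push_cast
      field_simp
    · simp only [hL, decide_false, if_false]
      push_cast
      field_simp
      simp
  simp_rw [hs] at h
  rw [Finset.sum_add_distrib, ← Finset.mul_sum, ← Finset.mul_sum,
    sum_perm_eq_fourCyclePendant] at h
  have h4 : 0 < 4 * (certDen : ℝ) := by linarith [certDen_pos]
  have h5 : 4 * (certDen : ℝ) * (∑ π : Equiv.Perm (Fin 5), flagPart (K.comap π) +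
      indDensity fourCyclePendant K) ≤ 4 * certDen * (15625 / 62208) := by linarith
  have := le_of_mul_le_mul_left h5 h4
  linarith

/-! ### The matrices of the certificate -/

/-- An entry of a weighted vector. -/
def weightEntry (p : ℕ × List ℤ) (k : Bool × Bool × Bool) : ℝ := ((p.2.getD (codeIndex k) 0 : ℤ) : ℝ)

/-- The matrix of the bilinear form given by a list of weighted vectors. -/
def weightMatrix {ι : Type} (L : List (ℕ × List ℤ)) (c : ι → Bool × Bool × Bool) : Matrix ι ι ℝ :=
  Matrix.of fun A B => (weightForm L (c A) (c B) : ℝ) / certDen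

lemma weightForm_cast (L : List (ℕ × List ℤ)) (a b : Bool × Bool × Bool) :
    (weightForm L a b : ℝ) =
      ∑ i : Fin L.length, (L[i].1 : ℝ) * (weightEntry L[i] a * weightEntry L[i] b) := by
  rw [weightForm, ← Fin.sum_univ_fun_getElem]
  push_cast
  rfl

section

variable {ι : Type} [Fintype ι] (L : List (ℕ × List ℤ)) (c : ι → Bool × Bool × Bool)

lemma weightMatrix_mulVec (x : ι → ℝ) (A : ι) :
    (weightMatrix L c *ᵥ x) A = ∑ i : Fin L.length,
      (L[i].1 : ℝ) * weightEntry L[i] (c A) * (∑ B, weightEntry L[i] (c B) * x B) / certDen := by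
  simp only [weightMatrix, Matrix.mulVec, dotProduct, Matrix.of_apply, weightForm_cast,
    Finset.sum_div, Finset.sum_mul, Finset.mul_sum]
  rw [Finset.sum_comm]
  refine Finset.sum_congr rfl fun i _ => Finset.sum_congr rfl fun B _ => ?_
  ring

/-- The form is a weighted sum of squares of linear forms; this gives both semi-definiteness and the
description of the kernel. -/
lemma weightMatrix_quadratic (x : ι → ℝ) :
    x ⬝ᵥ (weightMatrix L c *ᵥ x) = ∑ i : Fin L.length,
      (L[i].1 : ℝ) * (∑ B, weightEntry L[i] (c B) * x B) ^ 2 / certDen := by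
  simp only [dotProduct, weightMatrix_mulVec]
  simp_rw [Finset.mul_sum (s := (Finset.univ : Finset (Fin L.length)))]
  rw [Finset.sum_comm]
  refine Finset.sum_congr rfl fun i _ => ?_
  generalize hS : ∑ B, weightEntry L[i] (c B) * x B = S
  have h : ∀ B, x B * ((L[i].1 : ℝ) * weightEntry L[i] (c B) * S / certDen) =
      weightEntry L[i] (c B) * x B * ((L[i].1 : ℝ) * S / certDen) := fun B => by ring
  simp_rw [h, ← Finset.sum_mul, hS]
  ring

lemma weightMatrix_posSemidef : (weightMatrix L c).PosSemidef := by
  refine Matrix.PosSemidef.of_dotProduct_mulVec_nonneg ?_ fun x => ?_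
  · ext A B
    simp only [weightMatrix, Matrix.conjTranspose_apply, Matrix.of_apply, star_trivial,
      weightForm_cast]
    congr 1
    exact Finset.sum_congr rfl fun i _ => by ring
  · rw [star_trivial, weightMatrix_quadratic]
    exact Finset.sum_nonneg fun i _ =>
      div_nonneg (mul_nonneg (Nat.cast_nonneg _) (sq_nonneg _)) certDen_pos.le

/-- On a kernel vector the sum of squares vanishes, and since all weights are positive, so does each
linear form. -/
lemma weightMatrix_mulVec_eq_zero_iff (hL : ∀ p ∈ L, p.1 ≠ 0) (x : ι → ℝ) :
    weightMatrix L c *ᵥ x = 0 ↔ ∀ p ∈ L, ∑ A, weightEntry p (c A) * x A = 0 := by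
  constructor
  · intro h p hp
    have hq := weightMatrix_quadratic L c x
    rw [h, dotProduct_zero] at hq
    have hn : ∀ i ∈ (Finset.univ : Finset (Fin L.length)),
        0 ≤ (L[i].1 : ℝ) * (∑ B, weightEntry L[i] (c B) * x B) ^ 2 / certDen := fun i _ =>
      div_nonneg (mul_nonneg (Nat.cast_nonneg _) (sq_nonneg _)) certDen_pos.le
    have hz := (Finset.sum_eq_zero_iff_of_nonneg hn).1 hq.symm
    obtain ⟨j, hj, rfl⟩ := List.getElem_of_mem hp
    have := hz ⟨j, hj⟩ (Finset.mem_univ _)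
    rw [div_eq_zero_iff, or_iff_left certDen_pos.ne', mul_eq_zero, or_iff_right
      (by exact_mod_cast hL _ hp)] at this
    exact pow_eq_zero_iff two_ne_zero |>.1 this
  · intro h
    ext A
    rw [weightMatrix_mulVec]
    refine Finset.sum_eq_zero fun i _ => ?_
    rw [h L[i] (List.getElem_mem _)]
    simp

/-- The push-forward of a vector along the codes. -/
def codeSum (x : ι → ℝ) (k : Bool × Bool × Bool) : ℝ := ∑ A, if c A = k then x A else 0

/-- The linear forms see `x` only through its push-forward, so kernels can be computed in eight
explicit coordinates instead of on the quotient type of flags. -/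
lemma sum_mul_codeSum (x : ι → ℝ) (g : Bool × Bool × Bool → ℝ) :
    ∑ A, g (c A) * x A = ∑ k, g k * codeSum c x k := by
  simp only [codeSum, Finset.mul_sum]
  rw [Finset.sum_comm]
  refine Finset.sum_congr rfl fun A _ => ?_
  rw [Finset.sum_eq_single (c A)] <;> simp +contextual [eq_comm]

variable {c}

lemma codeSum_apply (hc : Function.Injective c) (x : ι → ℝ) (A : ι) :
    codeSum c x (c A) = x A := by
  classical
  simp [codeSum, hc.eq_iff]

lemma codeSum_eq_zero (x : ι → ℝ) {k : Bool × Bool × Bool} (hk : ∀ A, c A = k → x A = 0) :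
    codeSum c x k = 0 :=
  Finset.sum_eq_zero fun A _ => by
    split_ifs with h
    · exact hk A h
    · rfl

/-- If the codes are faithful and the equations of the list have a one-dimensional solution space,
then the matrix has a one-dimensional zero eigenspace. -/
lemma nullDim_weightMatrix_eq_one (hL : ∀ p ∈ L, p.1 ≠ 0) (hc : Function.Injective c)
    (v : Bool × Bool × Bool → ℝ) (hv : ∀ k, v k ≠ 0 → ∃ A, c A = k) (k₀ : Bool × Bool × Bool)
    (hk₀ : v k₀ ≠ 0) (hsol : ∀ p ∈ L, ∑ k, weightEntry p k * v k = 0)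
    (huniq : ∀ y : Bool × Bool × Bool → ℝ, (∀ k, (∀ A, c A ≠ k) → y k = 0) →
      (∀ p ∈ L, ∑ k, weightEntry p k * y k = 0) → ∃ t : ℝ, ∀ k, y k = t * v k) :
    nullDim (weightMatrix L c) = 1 := by
  have hsum : codeSum c (fun A => v (c A)) = v := by
    funext k
    by_cases hk : ∃ A, c A = k
    · obtain ⟨A, rfl⟩ := hk
      exact codeSum_apply hc _ A
    · rw [codeSum_eq_zero]
      · by_contra h
        exact hk (hv k (Ne.symm h))
      · exact fun A hA => absurd ⟨A, hA⟩ hk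
  have hmem : (fun A => v (c A)) ∈ LinearMap.ker (weightMatrix L c).mulVecLin := by
    rw [LinearMap.mem_ker, Matrix.mulVecLin_apply, weightMatrix_mulVec_eq_zero_iff L c hL]
    intro p hp
    rw [sum_mul_codeSum, hsum]
    exact hsol p hp
  obtain ⟨A₀, hA₀⟩ := hv k₀ hk₀
  have hne : (⟨_, hmem⟩ : LinearMap.ker (weightMatrix L c).mulVecLin) ≠ 0 := by
    intro h
    have := congrFun (congrArg Subtype.val h) A₀
    simp only [hA₀] at this
    exact hk₀ this
  unfold nullDim
  rw [finrank_eq_one_iff_of_nonzero' _ hne]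
  rintro ⟨x, hx⟩
  rw [LinearMap.mem_ker, Matrix.mulVecLin_apply, weightMatrix_mulVec_eq_zero_iff L c hL] at hx
  obtain ⟨t, ht⟩ := huniq (codeSum c x)
    (fun k hk => codeSum_eq_zero x fun A hA => absurd hA (hk A))
    (fun p hp => by rw [← sum_mul_codeSum]; exact hx p hp)
  refine ⟨t, Subtype.ext (funext fun A => ?_)⟩
  change t * v (c A) = x A
  rw [← codeSum_apply hc x A, ht]

end

/-- The matrices of the certificate for all types. -/
def certMatrix : ∀ {q : ℕ} (τ : SimpleGraph (Fin q)),
    Matrix (FlagClass τ ((5 + q) / 2)) (FlagClass τ ((5 + q) / 2)) ℝ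
  | 1, _ => weightMatrix certOne fun A => A.rep.pairCode
  | 3, τ => weightMatrix (certThree (boolAdj τ 0 1) (boolAdj τ 0 2) (boolAdj τ 1 2))
      fun A => A.rep.attachCode
  | _, _ => 0

lemma certMatrix_one (τ : SimpleGraph (Fin 1)) :
    certMatrix τ = weightMatrix certOne fun A => A.rep.pairCode := rfl

lemma certMatrix_three (τ : SimpleGraph (Fin 3)) :
    certMatrix τ = weightMatrix (certThree (boolAdj τ 0 1) (boolAdj τ 0 2) (boolAdj τ 1 2))
      fun A => A.rep.attachCode := rfl

lemma type_order_eq {q : ℕ} (h1 : 1 ≤ q) (h2 : q + 2 ≤ 5) (h3 : Even (q + 5)) :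
    q = 1 ∨ q = 3 := by
  have : q ≤ 3 := by omega
  interval_cases q
  · exact Or.inl rfl
  · exact absurd h3 (by decide)
  · exact Or.inr rfl

lemma certMatrix_posSemidef {q : ℕ} (τ : SimpleGraph (Fin q)) (h1 : 1 ≤ q) (h2 : q + 2 ≤ 5)
    (h3 : Even (q + 5)) : (certMatrix τ).PosSemidef := by
  rcases type_order_eq h1 h2 h3 with rfl | rfl
  · exact weightMatrix_posSemidef _ _
  · exact weightMatrix_posSemidef _ _

/-- For each number of edges at most one labelled type on three vertices carries a non-empty list.
As isomorphic types have equally many edges, this leaves one representative per class. -/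
lemma certThree_eq_nil_or : ∀ a b c a' b' c' : Bool,
    certThree a b c = [] ∨ certThree a' b' c' = [] ∨ (a, b, c) = (a', b', c') ∨
      a.toNat + b.toNat + c.toNat ≠ a'.toNat + b'.toNat + c'.toNat := by
  intro a b c a' b' c'
  cases a <;> cases b <;> cases c <;> cases a' <;> cases b' <;> cases c' <;>
    simp [certThree]

lemma graph_three_ext {τ τ' : SimpleGraph (Fin 3)} (h01 : boolAdj τ 0 1 = boolAdj τ' 0 1)
    (h02 : boolAdj τ 0 2 = boolAdj τ' 0 2) (h12 : boolAdj τ 1 2 = boolAdj τ' 1 2) : τ = τ' := by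
  simp only [boolAdj, decide_eq_decide] at h01 h02 h12
  have h := τ.adj_comm
  have h' := τ'.adj_comm
  ext i j
  fin_cases i <;> fin_cases j <;> simp <;> grind

lemma card_edges_three (τ τ' : SimpleGraph (Fin 3)) (e : τ ≃g τ') :
    (boolAdj τ 0 1).toNat + (boolAdj τ 0 2).toNat + (boolAdj τ 1 2).toNat =
      (boolAdj τ' 0 1).toNat + (boolAdj τ' 0 2).toNat + (boolAdj τ' 1 2).toNat := by
  have hsum : ∀ σ : SimpleGraph (Fin 3), ∑ i, ∑ j, (boolAdj σ i j).toNat =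
      2 * ((boolAdj σ 0 1).toNat + (boolAdj σ 0 2).toNat + (boolAdj σ 1 2).toNat) := by
    intro σ
    simp only [Fin.sum_univ_three, boolAdj_self, Bool.toNat_false, boolAdj_comm σ 1 0,
      boolAdj_comm σ 2 0, boolAdj_comm σ 2 1]
    ring
  have h : ∑ i, ∑ j, (boolAdj τ i j).toNat = ∑ i, ∑ j, (boolAdj τ' i j).toNat := by
    refine Fintype.sum_equiv e.toEquiv _ _ fun i => Fintype.sum_equiv e.toEquiv _ _ fun j => ?_
    congr 1
    exact decide_eq_decide.2 e.map_adj_iff.symm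
  rw [hsum, hsum] at h
  omega

lemma certMatrix_one_representative {q : ℕ} (τ τ' : SimpleGraph (Fin q)) (h1 : 1 ≤ q)
    (h2 : q + 2 ≤ 5) (h3 : Even (q + 5)) (hne : τ ≠ τ') (he : Nonempty (τ ≃g τ')) :
    certMatrix τ = 0 ∨ certMatrix τ' = 0 := by
  rcases type_order_eq h1 h2 h3 with rfl | rfl
  · refine absurd ?_ hne
    ext i j
    simp [Subsingleton.elim i j]
  · obtain ⟨e⟩ := he
    have hnil : ∀ {ι : Type} (c : ι → Bool × Bool × Bool), weightMatrix [] c = 0 := by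
      intro ι c
      ext A B
      simp [weightMatrix, weightForm]
    rw [certMatrix_three, certMatrix_three]
    rcases certThree_eq_nil_or (boolAdj τ 0 1) (boolAdj τ 0 2) (boolAdj τ 1 2)
      (boolAdj τ' 0 1) (boolAdj τ' 0 2) (boolAdj τ' 1 2) with h | h | h | h
    · left; rw [h, hnil]
    · right; rw [h, hnil]
    · simp only [Prod.mk.injEq] at h
      exact absurd (graph_three_ext h.1 h.2.1 h.2.2) hne
    · exact absurd (card_edges_three τ τ' e) h

/-! ### The zero eigenspaces of the matrices -/

lemma decide_eq_of_iff {p : Prop} {_ : Decidable p} {b : Bool} (h : p ↔ b = true) :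
    decide p = b := by
  rw [Bool.eq_iff_iff, decide_eq_true_eq, h]

namespace GraphFlag

/-- Flags are isomorphic if their vertices can be enumerated in the same way. -/
lemma iso_of_enumeration {q s : ℕ} {τ : SimpleGraph (Fin q)} {A B : GraphFlag τ (Fin s)}
    {a b : Fin s → Fin s} (ha : Function.Injective a) (hb : Function.Injective b)
    (hadj : ∀ i j, A.graph.Adj (a i) (a j) ↔ B.graph.Adj (b i) (b j))
    (hroot : ∀ i, ∃ k, a k = A.root i ∧ b k = B.root i) : A.Iso B := by
  let ea := Equiv.ofBijective a (Finite.injective_iff_bijective.1 ha)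
  let eb := Equiv.ofBijective b (Finite.injective_iff_bijective.1 hb)
  have hea : ∀ k, ea.symm (a k) = k := fun k => ea.symm_apply_apply k
  refine ⟨{ toEquiv := ea.symm.trans eb, map_rel_iff' := ?_ }, fun i => ?_⟩
  · intro x y
    obtain ⟨i, rfl⟩ := ea.surjective x
    obtain ⟨j, rfl⟩ := ea.surjective y
    simp only [Equiv.trans_apply, Equiv.symm_apply_apply]
    exact (hadj i j).symm
  · obtain ⟨k, hk1, hk2⟩ := hroot i
    change eb (ea.symm (A.root i)) = B.root i
    rw [← hk1, hea, ← hk2]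
    rfl

/-- The unlabelled vertex of a flag on four vertices with three roots. -/
lemma exists_free_vertex {τ : SimpleGraph (Fin 3)} (A : GraphFlag τ (Fin 4)) :
    ∃ u, ∀ v, v ∉ Set.range A.root ↔ v = u := by
  classical
  have hc : (Finset.univ.map A.root.toEmbedding)ᶜ.card = 1 := by
    rw [Finset.card_compl]; simp
  obtain ⟨u, hu⟩ := Finset.card_eq_one.1 hc
  refine ⟨u, fun v => ?_⟩
  rw [← Finset.mem_singleton, ← hu]
  simp

/-- The roots already span the type, so the flag is determined by the neighbours of its one
unlabelled vertex. -/
lemma iso_of_attachCode_eq {τ : SimpleGraph (Fin 3)} {A B : GraphFlag τ (Fin 4)}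
    (h : A.attachCode = B.attachCode) : A.Iso B := by
  obtain ⟨u, hu⟩ := A.exists_free_vertex
  obtain ⟨w, hw⟩ := B.exists_free_vertex
  simp only [attachCode, hu, hw, exists_eq_left, Prod.mk.injEq, decide_eq_decide] at h
  have hadj : ∀ i, A.graph.Adj u (A.root i) ↔ B.graph.Adj w (B.root i) := by
    intro i
    fin_cases i
    exacts [h.1, h.2.1, h.2.2]
  refine iso_of_enumeration (a := Fin.cons u A.root) (b := Fin.cons w B.root)
    (Fin.cons_injective_iff.2 ⟨(hu u).2 rfl, A.root.injective⟩)
    (Fin.cons_injective_iff.2 ⟨(hw w).2 rfl, B.root.injective⟩) ?_ fun i => ⟨i.succ, rfl, rfl⟩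
  intro i j
  refine Fin.cases ?_ (fun i => ?_) i <;> refine Fin.cases ?_ (fun j => ?_) j
  · simp
  · simpa using hadj j
  · simpa [A.graph.adj_comm, B.graph.adj_comm] using hadj i
  · simp only [Fin.cons_succ]
    rw [A.root.map_adj_iff, B.root.map_adj_iff]

/-- The two unlabelled vertices of a flag on three vertices with one root, in an order that is
determined by the code as far as possible. -/
lemma exists_free_pair {τ : SimpleGraph (Fin 1)} (A : GraphFlag τ (Fin 3)) :
    ∃ x y, Function.Injective ![A.root 0, x, y] ∧
      A.pairCode = (boolAdj A.graph (A.root 0) x, !boolAdj A.graph (A.root 0) y,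
        boolAdj A.graph x y) := by
  classical
  have hc : (Finset.univ.erase (A.root 0)).card = 2 := by
    rw [Finset.card_erase_of_mem (Finset.mem_univ _)]; simp
  obtain ⟨x, y, hxy, hS⟩ := Finset.card_eq_two.1 hc
  have hr : ∀ v, v ∉ Set.range A.root ↔ v = x ∨ v = y := by
    intro v
    have : v ∈ Finset.univ.erase (A.root 0) ↔ v = x ∨ v = y := by rw [hS]; simp
    rw [← this, Set.mem_range, Finset.mem_erase, Fin.exists_fin_one]
    simp [eq_comm]
  have hx : x ≠ A.root 0 := fun h => (hr x).2 (Or.inl rfl) ⟨0, h.symm⟩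
  have hy : y ≠ A.root 0 := fun h => (hr y).2 (Or.inr rfl) ⟨0, h.symm⟩
  have hinj : ∀ x y : Fin 3, x ≠ y → x ≠ A.root 0 → y ≠ A.root 0 →
      Function.Injective ![A.root 0, x, y] := by
    intro x y h1 h2 h3 i j
    fin_cases i <;> fin_cases j <;> simp [h1, h2, h3, h1.symm, h2.symm, h3.symm]
  have e1 := A.graph.adj_comm (A.root 0) x
  have e2 := A.graph.adj_comm (A.root 0) y
  have e3 := A.graph.adj_comm x y
  -- If exactly one unlabelled vertex is a neighbour of the root, it has to come first; otherwise
  -- either order works.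
  by_cases hcase : A.graph.Adj y (A.root 0) ∧ ¬ A.graph.Adj x (A.root 0)
  · refine ⟨y, x, hinj y x hxy.symm hy hx, ?_⟩
    simp only [pairCode, hr, boolAdj, Prod.mk.injEq, ← decide_not, decide_eq_decide,
      or_and_right, exists_or, exists_eq_left, e1, e2, SimpleGraph.irrefl]
    tauto
  · refine ⟨x, y, hinj x y hxy hx hy, ?_⟩
    simp only [pairCode, hr, boolAdj, Prod.mk.injEq, ← decide_not, decide_eq_decide,
      or_and_right, exists_or, exists_eq_left, e1, e2, SimpleGraph.irrefl]
    tauto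

/-- With the unlabelled vertices in the order of `exists_free_pair`, the entries of the code are the
three adjacencies of the flag, one of them negated. -/
lemma iso_of_pairCode_eq {τ : SimpleGraph (Fin 1)} {A B : GraphFlag τ (Fin 3)}
    (h : A.pairCode = B.pairCode) : A.Iso B := by
  obtain ⟨x, y, hi, hA⟩ := A.exists_free_pair
  obtain ⟨z, w, hj, hB⟩ := B.exists_free_pair
  rw [hA, hB, Prod.mk.injEq, Prod.mk.injEq, Bool.not_inj_iff] at h
  simp only [boolAdj, decide_eq_decide] at h
  refine iso_of_enumeration hi hj ?_ fun i => ⟨0, by rw [Subsingleton.elim i 0]; simp⟩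
  have h1 := A.graph.adj_comm
  have h2 := B.graph.adj_comm
  intro i j
  fin_cases i <;> fin_cases j <;> simp <;> grind

/-- The flag with three roots and a fourth vertex with prescribed neighbours. -/
def attachFlag (τ : SimpleGraph (Fin 3)) (b : Fin 3 → Bool) : GraphFlag τ (Option (Fin 3)) where
  graph :=
    { Adj := fun x y => match x, y with
        | none, none => False
        | none, some i => b i = true
        | some i, none => b i = true
        | some i, some j => τ.Adj i j
      symm := ⟨by
        intro x y h
        cases x <;> cases y
        · exact h
        · exact h
        · exact h
        · exact SimpleGraph.Adj.symm h⟩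
      loopless := ⟨by
        intro x h
        cases x
        · exact h
        · exact τ.irrefl h⟩ }
  root :=
    { toFun := some
      inj' := Option.some_injective _
      map_rel_iff' := Iff.rfl }

lemma attachCode_attachFlag (τ : SimpleGraph (Fin 3)) (b : Fin 3 → Bool) :
    (attachFlag τ b).attachCode = (b 0, b 1, b 2) := by
  have h : ∀ i, (∃ v, v ∉ Set.range (attachFlag τ b).root ∧
      (attachFlag τ b).graph.Adj v ((attachFlag τ b).root i)) ↔ b i = true := by
    intro i
    constructor
    · rintro ⟨v, hv, h⟩
      cases v with
      | none => exact h
      | some j => exact absurd ⟨j, rfl⟩ hv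
    · intro h
      refine ⟨none, ?_, h⟩
      rintro ⟨j, hj⟩
      exact Option.some_ne_none j hj
  simp only [attachCode, h, Bool.decide_eq_true]

/-- The flag on three vertices with one root and prescribed adjacencies. -/
def pairFlag (τ : SimpleGraph (Fin 1)) (a b c : Bool) : GraphFlag τ (Fin 3) where
  graph := SimpleGraph.fromRel fun x y : Fin 3 =>
    (x = 0 ∧ y = 1 ∧ a = true) ∨ (x = 0 ∧ y = 2 ∧ b = true) ∨ (x = 1 ∧ y = 2 ∧ c = true)
  root :=
    { toFun := fun _ => 0
      inj' := fun _ _ _ => Subsingleton.elim _ _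
      map_rel_iff' := by intro i j; simp [Subsingleton.elim i j] }

lemma pairCode_pairFlag (τ : SimpleGraph (Fin 1)) (a b c : Bool) :
    (pairFlag τ a b c).pairCode = (a || b, !a || !b, c) := by
  have hr : ∀ v, v ∉ Set.range (pairFlag τ a b c).root ↔ v = 1 ∨ v = 2 := by
    intro v
    have : (∃ i, (pairFlag τ a b c).root i = v) ↔ 0 = v := by
      constructor
      · rintro ⟨i, h⟩; exact h
      · intro h; exact ⟨0, h⟩
    rw [Set.mem_range, this]
    fin_cases v <;> simp
  have h0 : (pairFlag τ a b c).root 0 = 0 := rfl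
  have ha : ∀ x y, (pairFlag τ a b c).graph.Adj x y ↔ x ≠ y ∧
      (((x = 0 ∧ y = 1 ∧ a = true) ∨ (x = 0 ∧ y = 2 ∧ b = true) ∨ (x = 1 ∧ y = 2 ∧ c = true)) ∨
      ((y = 0 ∧ x = 1 ∧ a = true) ∨ (y = 0 ∧ x = 2 ∧ b = true) ∨ (y = 1 ∧ x = 2 ∧ c = true))) :=
    fun x y => SimpleGraph.fromRel_adj _ x y
  refine Prod.ext (decide_eq_of_iff ?_) (Prod.ext (decide_eq_of_iff ?_) (decide_eq_of_iff ?_))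
  · simp only [hr, h0, ha, or_and_right, exists_or, exists_eq_left]
    simp
  · simp only [hr, h0, ha, or_and_right, exists_or, exists_eq_left]
    simp
  · simp only [hr, ha, or_and_right, exists_or, exists_eq_left]
    simp

end GraphFlag

namespace FlagClass

lemma attachCode_injective {τ : SimpleGraph (Fin 3)} :
    Function.Injective fun A : FlagClass τ 4 => A.rep.attachCode := fun A B h => by
  rw [← mk_rep A, ← mk_rep B, mk_eq_iff]
  exact GraphFlag.iso_of_attachCode_eq h

lemma pairCode_injective {τ : SimpleGraph (Fin 1)} :
    Function.Injective fun A : FlagClass τ 3 => A.rep.pairCode := fun A B h => by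
  rw [← mk_rep A, ← mk_rep B, mk_eq_iff]
  exact GraphFlag.iso_of_pairCode_eq h

lemma exists_attachCode_eq (τ : SimpleGraph (Fin 3)) (k : Bool × Bool × Bool) :
    ∃ A : FlagClass τ 4, A.rep.attachCode = k := by
  obtain ⟨a, b, c⟩ := k
  let A := (GraphFlag.attachFlag τ ![a, b, c]).transport (finSuccEquivLast (n := 3)).symm
  refine ⟨mk A, ?_⟩
  rw [(rep_mk_iso A).attachCode_eq, ← (GraphFlag.iso_transport _ _).attachCode_eq,
    GraphFlag.attachCode_attachFlag]
  rfl

lemma exists_pairCode_eq (τ : SimpleGraph (Fin 1)) (a b c : Bool) :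
    ∃ A : FlagClass τ 3, A.rep.pairCode = (a || b, !a || !b, c) :=
  ⟨mk (GraphFlag.pairFlag τ a b c), by
    rw [(rep_mk_iso _).pairCode_eq, GraphFlag.pairCode_pairFlag]⟩

lemma pairCode_ne {τ : SimpleGraph (Fin 1)} (A : FlagClass τ 3) (c : Bool) :
    A.rep.pairCode ≠ (false, false, c) := by
  obtain ⟨v, hv⟩ := exists_ne (A.rep.root 0)
  have hv' : v ∉ Set.range A.rep.root := by
    rintro ⟨i, rfl⟩
    rw [Subsingleton.elim i 0] at hv
    exact hv rfl
  intro h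
  simp only [GraphFlag.pairCode, Prod.mk.injEq, decide_eq_false_iff_not] at h
  by_cases hadj : A.rep.graph.Adj v (A.rep.root 0)
  · exact h.1 ⟨v, hv', hadj⟩
  · exact h.2.1 ⟨v, hv', hadj⟩

end FlagClass

lemma sum_code (f : Bool × Bool × Bool → ℝ) :
    ∑ k, f k = f (false, false, false) + f (true, false, false) + f (false, true, false) +
      f (true, true, false) + f (false, false, true) + f (true, false, true) +
      f (false, true, true) + f (true, true, true) := by
  simp only [Fintype.sum_prod_type, Fintype.sum_bool]
  ring

lemma forall_code {P : Bool × Bool × Bool → Prop} : (∀ k, P k) ↔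
    P (false, false, false) ∧ P (true, false, false) ∧ P (false, true, false) ∧
      P (true, true, false) ∧ P (false, false, true) ∧ P (true, false, true) ∧
      P (false, true, true) ∧ P (true, true, true) := by
  simp only [Prod.forall, Bool.forall_bool]
  tauto

/-- The frequencies of the flags of the single-vertex type in the extremal graphs, up to a
factor. -/
def nullVectorOne : ℕ × List ℤ := (1, [0, 25, 39, 20, 0, 0, 10, 50])

/-- The frequencies of the flags of the cherry in the extremal graphs, up to a factor. -/
def nullVectorCherry : ℕ × List ℤ := (1, [7, 30, 5, 0, 5, 0, 25, 0])

lemma nullDim_certMatrix_typeOne : nullDim (certMatrix typeOne) = 1 := by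
  refine nullDim_weightMatrix_eq_one (ι := FlagClass typeOne 3) certOne
    (by simp [certOne]) FlagClass.pairCode_injective (weightEntry nullVectorOne) ?_
    (false, true, false) (by simp [weightEntry, nullVectorOne, codeIndex]) ?_ ?_
  -- The three codes listed first are the zeros of the null vector: two belong to no flag, and the
  -- third is the triangle, which bipartite graphs do not contain.
  · have h : ∀ k, (k = (false, false, false) ∨ k = (false, false, true) ∨ k = (true, false, true)) ∨
        ∃ a b c : Bool, (a || b, !a || !b, c) = k := by decide
    intro k hk
    rcases h k with (rfl | rfl | rfl) | ⟨a, b, c, rfl⟩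
    · simp [weightEntry, nullVectorOne, codeIndex] at hk
    · simp [weightEntry, nullVectorOne, codeIndex] at hk
    · simp [weightEntry, nullVectorOne, codeIndex] at hk
    · exact FlagClass.exists_pairCode_eq typeOne a b c
  · simp only [sum_code, certOne, List.forall_mem_cons, List.not_mem_nil, false_imp_iff,
      implies_true]
    norm_num [weightEntry, nullVectorOne, codeIndex]
  · intro y hy hsol
    -- No equation involves the two unrealizable codes, so their coordinates must be removed for the
    -- five equations to leave a line.
    have h0 := hy (false, false, false) fun A => A.pairCode_ne false
    have h1 := hy (false, false, true) fun A => A.pairCode_ne true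
    simp only [sum_code, certOne, List.forall_mem_cons, List.not_mem_nil, false_imp_iff,
      implies_true] at hsol
    norm_num [weightEntry, codeIndex] at hsol
    obtain ⟨e1, e2, e3, e4, e5⟩ := hsol
    -- 39 is the entry of the null vector at this code.
    refine ⟨y (false, true, false) / 39, ?_⟩
    rw [forall_code]
    refine ⟨?_, ?_, ?_, ?_, ?_, ?_, ?_, ?_⟩ <;>
      norm_num [weightEntry, nullVectorOne, codeIndex] <;> linarith

lemma boolAdj_typeCherry : boolAdj typeCherry 0 1 = true ∧ boolAdj typeCherry 0 2 = true ∧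
    boolAdj typeCherry 1 2 = false := by
  simp [boolAdj, typeCherry]

lemma boolAdj_typeEmpty : boolAdj typeEmpty 0 1 = false ∧ boolAdj typeEmpty 0 2 = false ∧
    boolAdj typeEmpty 1 2 = false := by
  simp [boolAdj, typeEmpty]

lemma boolAdj_typeEdge : boolAdj typeEdge 0 1 = true ∧ boolAdj typeEdge 0 2 = false ∧
    boolAdj typeEdge 1 2 = false := by
  simp [boolAdj, typeEdge]

lemma nullDim_certMatrix_typeCherry : nullDim (certMatrix typeCherry) = 1 := by
  rw [certMatrix_three, boolAdj_typeCherry.1, boolAdj_typeCherry.2.1, boolAdj_typeCherry.2.2]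
  refine nullDim_weightMatrix_eq_one (ι := FlagClass typeCherry 4) certCherry
    (by simp [certCherry]) FlagClass.attachCode_injective (weightEntry nullVectorCherry)
    (fun k _ => FlagClass.exists_attachCode_eq typeCherry k)
    (false, false, false) (by simp [weightEntry, nullVectorCherry, codeIndex]) ?_ ?_
  · simp only [sum_code, certCherry, List.forall_mem_cons, List.not_mem_nil, false_imp_iff,
      implies_true]
    norm_num [weightEntry, nullVectorCherry, codeIndex]
  · intro y _ hsol
    simp only [sum_code, certCherry, List.forall_mem_cons, List.not_mem_nil, false_imp_iff,
      implies_true] at hsol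
    norm_num [weightEntry, codeIndex] at hsol
    obtain ⟨e1, e2, e3, e4, e5, e6, e7⟩ := hsol
    -- 7 is the entry of the null vector at this code.
    refine ⟨y (false, false, false) / 7, ?_⟩
    rw [forall_code]
    refine ⟨?_, ?_, ?_, ?_, ?_, ?_, ?_, ?_⟩ <;>
      norm_num [weightEntry, nullVectorCherry, codeIndex] <;> linarith

namespace GraphFlag

lemma two_le_rootEdges {τ : SimpleGraph (Fin 3)} (A : GraphFlag τ (Fin 4)) {i j : Fin 3}
    (hij : i ≠ j) (hi : ∃ v, v ∉ Set.range A.root ∧ A.graph.Adj v (A.root i))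
    (hj : ∃ v, v ∉ Set.range A.root ∧ A.graph.Adj v (A.root j)) : 2 ≤ A.rootEdges := by
  obtain ⟨v, hv, hvi⟩ := hi
  obtain ⟨w, hw, hwj⟩ := hj
  change 1 < Nat.card _
  rw [Finite.one_lt_card_iff_nontrivial]
  refine ⟨⟨(v, i), hv, hvi⟩, ⟨(w, j), hw, hwj⟩, fun h => hij ?_⟩
  exact congrArg (fun p => p.1.2) h

end GraphFlag

/-- The matrix has no sparse null vector if the equations of its list have no non-trivial solution
that is supported by codes with at most one neighbour. -/
lemma noSparseNullVector_weightMatrix {τ : SimpleGraph (Fin 3)} (L : List (ℕ × List ℤ))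
    (hL : ∀ p ∈ L, p.1 ≠ 0)
    (huniq : ∀ y : Bool × Bool × Bool → ℝ, (∀ b, y (true, true, b) = 0) →
      (∀ b, y (true, b, true) = 0) → (∀ b, y (b, true, true) = 0) →
      (∀ p ∈ L, ∑ k, weightEntry p k * y k = 0) → ∀ k, y k = 0) :
    NoSparseNullVector (weightMatrix L fun A : FlagClass τ 4 => A.rep.attachCode) := by
  intro x hx hsparse
  rw [weightMatrix_mulVec_eq_zero_iff L _ hL] at hx
  -- A code with two positive entries means at least two edges to the roots, so a sparse vector is
  -- supported on the four remaining codes.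
  have hzero : ∀ (i j : Fin 3), i ≠ j → ∀ A : FlagClass τ 4,
      (∃ v, v ∉ Set.range A.rep.root ∧ A.rep.graph.Adj v (A.rep.root i)) →
      (∃ v, v ∉ Set.range A.rep.root ∧ A.rep.graph.Adj v (A.rep.root j)) → x A = 0 := by
    intro i j hij A hi hj
    by_contra hne
    have h1 := hsparse A hne
    have h2 := A.rep.two_le_rootEdges hij hi hj
    change A.rep.rootEdges ≤ 1 at h1
    omega
  have hy := huniq (codeSum (fun A : FlagClass τ 4 => A.rep.attachCode) x)
    (fun b => codeSum_eq_zero x fun A hA => by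
      simp only [GraphFlag.attachCode, Prod.mk.injEq, decide_eq_true_eq] at hA
      exact hzero 0 1 (by decide) A hA.1 hA.2.1)
    (fun b => codeSum_eq_zero x fun A hA => by
      simp only [GraphFlag.attachCode, Prod.mk.injEq, decide_eq_true_eq] at hA
      exact hzero 0 2 (by decide) A hA.1 hA.2.2)
    (fun b => codeSum_eq_zero x fun A hA => by
      simp only [GraphFlag.attachCode, Prod.mk.injEq, decide_eq_true_eq] at hA
      exact hzero 1 2 (by decide) A hA.2.1 hA.2.2)
    (fun p hp => by rw [← sum_mul_codeSum]; exact hx p hp)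
  funext A
  rw [← codeSum_apply FlagClass.attachCode_injective x A, hy]
  rfl

lemma noSparseNullVector_typeEmpty : NoSparseNullVector (certMatrix typeEmpty) := by
  rw [certMatrix_three, boolAdj_typeEmpty.1, boolAdj_typeEmpty.2.1, boolAdj_typeEmpty.2.2]
  refine noSparseNullVector_weightMatrix certEmpty (by simp [certEmpty]) ?_
  intro y h1 h2 h3 hsol
  rw [Bool.forall_bool] at h1 h2 h3
  simp only [sum_code, certEmpty, List.forall_mem_cons, List.not_mem_nil, false_imp_iff,
    implies_true] at hsol
  norm_num [weightEntry, codeIndex, h1, h2, h3] at hsol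
  obtain ⟨e1, e2, e3, e4, e5⟩ := hsol
  rw [forall_code]
  refine ⟨?_, ?_, ?_, h1.1, ?_, h2.1, h3.1, h1.2⟩ <;> linarith

lemma noSparseNullVector_typeEdge : NoSparseNullVector (certMatrix typeEdge) := by
  rw [certMatrix_three, boolAdj_typeEdge.1, boolAdj_typeEdge.2.1, boolAdj_typeEdge.2.2]
  refine noSparseNullVector_weightMatrix certEdge (by simp [certEdge]) ?_
  intro y h1 h2 h3 hsol
  rw [Bool.forall_bool] at h1 h2 h3
  simp only [sum_code, certEdge, List.forall_mem_cons, List.not_mem_nil, false_imp_iff,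
    implies_true] at hsol
  norm_num [weightEntry, codeIndex, h1, h2, h3] at hsol
  rw [forall_code]
  refine ⟨?_, ?_, ?_, h1.1, ?_, h2.1, h3.1, h1.2⟩ <;> linarith

/-! ### The flag algebra identity -/

/-- The left side counts the non-injective maps from a 5-set; 10 is the number of pairs that may
collide. -/
lemma pow_five_sub_descFactorial_le (n : ℕ) :
    (n : ℝ) ^ 5 - (n.descFactorial 5 : ℝ) ≤ 10 * (n : ℝ) ^ 4 := by
  rcases lt_or_ge n 4 with h | h
  · interval_cases n <;> norm_num [Nat.descFactorial]
  -- With `n = 4 + m` the truncated subtractions in the descending factorial are exact.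
  · obtain ⟨m, rfl⟩ := Nat.exists_eq_add_of_le h
    have : (4 + m).descFactorial 5 = (4 + m) * (3 + m) * (2 + m) * (1 + m) * m := by
      simp only [Nat.descFactorial_succ, Nat.descFactorial_zero]
      have h1 : 4 + m - 4 = m := by omega
      have h2 : 4 + m - 3 = 1 + m := by omega
      have h3 : 4 + m - 2 = 2 + m := by omega
      have h4 : 4 + m - 1 = 3 + m := by omega
      rw [h1, h2, h3, h4]
      simp only [Nat.sub_zero]
      ring
    rw [this]
    push_cast
    have hm : (0 : ℝ) ≤ m := Nat.cast_nonneg m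
    nlinarith [mul_nonneg hm hm, mul_nonneg (mul_nonneg hm hm) hm]

/-- A sum over maps from `Fin 5` that include all injective maps is close to the sum over
embeddings. -/
lemma abs_sum_sub_sum_embedding_le {ι : Type*} {n : ℕ} (I : Finset ι) (i : ι → Fin 5 → Fin n)
    (hinj : Set.InjOn i I) (hsurj : ∀ φ : Fin 5 ↪ Fin n, ∃ p ∈ I, i p = φ)
    (w : (Fin 5 → Fin n) → ℝ) {b : ℝ} (hb : 0 ≤ b) (hw : ∀ g, |w g| ≤ b) :
    |∑ p ∈ I, w (i p) - ∑ φ : Fin 5 ↪ Fin n, w φ| ≤ 10 * b * (n : ℝ) ^ 4 := by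
  classical
  let J : Finset (Fin 5 → Fin n) := Finset.univ.map ⟨fun φ : Fin 5 ↪ Fin n => (φ : Fin 5 → Fin n),
    DFunLike.coe_injective⟩
  have hJ : ∑ φ : Fin 5 ↪ Fin n, w φ = ∑ g ∈ J, w g := by
    rw [Finset.sum_map]; rfl
  have hI : ∑ p ∈ I, w (i p) = ∑ g ∈ I.image i, w g := by
    rw [Finset.sum_image hinj]
  have hsub : J ⊆ I.image i := by
    intro g hg
    obtain ⟨φ, -, rfl⟩ := Finset.mem_map.1 hg
    obtain ⟨p, hp, h⟩ := hsurj φ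
    exact Finset.mem_image.2 ⟨p, hp, h⟩
  have hJc : J.card = n.descFactorial 5 := by
    rw [Finset.card_map, Finset.card_univ, Fintype.card_embedding_eq]; simp
  have hIc : ((I.image i).card : ℝ) ≤ (n : ℝ) ^ 5 := by
    have := Finset.card_le_univ (I.image i)
    rw [Fintype.card_fun, Fintype.card_fin, Fintype.card_fin] at this
    exact_mod_cast this
  have hc : ((I.image i \ J).card : ℝ) ≤ 10 * (n : ℝ) ^ 4 := by
    have h := Finset.card_sdiff_add_card_eq_card hsub
    have h' : ((I.image i \ J).card : ℝ) + J.card = (I.image i).card := by exact_mod_cast h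
    have := pow_five_sub_descFactorial_le n
    rw [hJc] at h'
    linarith
  -- Only non-injective maps remain in the difference.
  rw [hI, hJ, ← Finset.sum_sdiff hsub, add_sub_cancel_right]
  calc |∑ g ∈ I.image i \ J, w g| ≤ ∑ g ∈ I.image i \ J, |w g| := Finset.abs_sum_le_sum_abs _ _
    _ ≤ ∑ g ∈ I.image i \ J, b := Finset.sum_le_sum fun g _ => hw g
    _ = (I.image i \ J).card * b := by rw [Finset.sum_const, nsmul_eq_mul]
    _ ≤ 10 * (n : ℝ) ^ 4 * b := by gcongr
    _ = 10 * b * (n : ℝ) ^ 4 := by ring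

lemma boolAdj_iff {V : Type} {K : SimpleGraph V} {x y : V} : boolAdj K x y = true ↔ K.Adj x y := by
  simp [boolAdj]

section

variable {n : ℕ} (G : SimpleGraph (Fin n))

/-- The index set for pairs of flags with three roots. -/
def tripleIndices (n : ℕ) : Finset (Σ _ : Fin 3 ↪ Fin n, Fin n × Fin n) :=
  Finset.univ.sigma fun f => (Finset.univ.map f)ᶜ ×ˢ (Finset.univ.map f)ᶜ

/-- The vertices of a pair of flags with three roots. -/
def tripleMap (p : Σ _ : Fin 3 ↪ Fin n, Fin n × Fin n) : Fin 5 → Fin n :=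
  ![p.1 0, p.1 1, p.1 2, p.2.1, p.2.2]

/-- The index set for pairs of flags with one root. -/
def rootIndices (n : ℕ) : Finset (Σ _ : Fin 1 ↪ Fin n, (Fin n × Fin n) × Fin n × Fin n) :=
  Finset.univ.sigma fun f =>
    (Finset.univ.erase (f 0)).offDiag ×ˢ (Finset.univ.erase (f 0)).offDiag

/-- The vertices of a pair of flags with one root. -/
def rootMap (p : Σ _ : Fin 1 ↪ Fin n, (Fin n × Fin n) × Fin n × Fin n) : Fin 5 → Fin n :=
  ![p.1 0, p.2.1.1, p.2.1.2, p.2.2.1, p.2.2.2]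

lemma tripleMap_injective : Function.Injective (tripleMap (n := n)) := by
  rintro ⟨f, x, y⟩ ⟨g, z, w⟩ h
  have h0 := congrFun h 0
  have h1 := congrFun h 1
  have h2 := congrFun h 2
  have h3 := congrFun h 3
  have h4 := congrFun h 4
  simp only [tripleMap] at h0 h1 h2 h3 h4
  have hf : f = g := by
    ext i
    fin_cases i
    exacts [congrArg Fin.val h0, congrArg Fin.val h1, congrArg Fin.val h2]
  subst hf
  have h3' : x = z := h3
  have h4' : y = w := h4
  rw [h3', h4']

lemma rootMap_injective : Function.Injective (rootMap (n := n)) := by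
  rintro ⟨f, ⟨x, y⟩, x', y'⟩ ⟨g, ⟨z, w⟩, z', w'⟩ h
  have h0 : f 0 = g 0 := congrFun h 0
  have h1 : x = z := congrFun h 1
  have h2 : y = w := congrFun h 2
  have h3 : x' = z' := congrFun h 3
  have h4 : y' = w' := congrFun h 4
  have hf : f = g := by
    ext i
    rw [Subsingleton.elim i 0, h0]
  rw [hf, h1, h2, h3, h4]

lemma exists_tripleMap_eq (φ : Fin 5 ↪ Fin n) : ∃ p ∈ tripleIndices n, tripleMap p = φ := by
  refine ⟨⟨(⟨Fin.castLE (by decide), Fin.castLE_injective _⟩ : Fin 3 ↪ Fin 5).trans φ,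
    φ 3, φ 4⟩, ?_, ?_⟩
  · simp only [tripleIndices, Finset.mem_sigma, Finset.mem_univ, Finset.mem_product,
      Finset.mem_compl, Finset.mem_map, true_and, Function.Embedding.trans_apply,
      Function.Embedding.coeFn_mk, φ.injective.eq_iff]
    constructor <;> decide
  · funext i
    fin_cases i <;> rfl

lemma exists_rootMap_eq (φ : Fin 5 ↪ Fin n) : ∃ p ∈ rootIndices n, rootMap p = φ := by
  refine ⟨⟨(⟨Fin.castLE (by decide), Fin.castLE_injective _⟩ : Fin 1 ↪ Fin 5).trans φ,
    (φ 1, φ 2), φ 3, φ 4⟩, ?_, ?_⟩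
  · simp only [rootIndices, Finset.mem_sigma, Finset.mem_univ, Finset.mem_product,
      Finset.mem_offDiag, Finset.mem_erase, true_and, and_true, Function.Embedding.trans_apply,
      Function.Embedding.coeFn_mk, ne_eq, φ.injective.eq_iff]
    decide
  · funext i
    fin_cases i <;> rfl

/-- Both flags of a product share the three roots and add one vertex each; the two added vertices
are distinct from the roots but may coincide. -/
lemma sum_quadratic_three :
    ∑ f : Fin 3 ↪ Fin n, flagVector ((5 + 3) / 2) (GraphFlag.ofInjection G f) ⬝ᵥ
      (certMatrix (G.comap f) *ᵥ flagVector ((5 + 3) / 2) (GraphFlag.ofInjection G f)) =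
    ∑ p ∈ tripleIndices n, (triplePart (boolAdj (G.comap (tripleMap p))) : ℝ) / certDen := by
  rw [tripleIndices, Finset.sum_sigma]
  refine Finset.sum_congr rfl fun f _ => ?_
  rw [Finset.sum_product, certMatrix_three]
  refine (flagVector_quadratic (s := 4) (GraphFlag.ofInjection G f) (by decide)
    (fun a b => (weightForm (certThree (boolAdj (G.comap f) 0 1) (boolAdj (G.comap f) 0 2)
      (boolAdj (G.comap f) 1 2)) a b : ℝ) / certDen)
    (fun A => A.rep.attachCode)
    (fun X => ((GraphFlag.ofInjection G f).restrict (X : Set (Fin n))).attachCode)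
    (fun A X _ h => h.attachCode_eq)).trans ?_
  have hcode : ∀ x ∈ (Finset.univ.map f)ᶜ,
      ((GraphFlag.ofInjection G f).restrict (({x} : Finset (Fin n)) : Set (Fin n))).attachCode =
        (boolAdj G x (f 0), boolAdj G x (f 1), boolAdj G x (f 2)) := by
    intro x hx
    rw [GraphFlag.attachCode_restrict]
    · refine Prod.ext (decide_eq_of_iff ?_)
        (Prod.ext (decide_eq_of_iff ?_) (decide_eq_of_iff ?_)) <;>
      · rw [boolAdj_iff, Finset.coe_singleton]
        simp only [Set.mem_singleton_iff, exists_eq_left]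
        rfl
    · intro i hi
      simp only [Finset.coe_singleton, Set.mem_singleton_iff] at hi
      simp only [Finset.mem_compl, Finset.mem_map, Finset.mem_univ, true_and] at hx
      exact hx ⟨i, hi⟩
  rw [GraphFlag.sum_freeSets_four]
  refine Finset.sum_congr rfl fun x hx => ?_
  rw [GraphFlag.sum_freeSets_four]
  refine Finset.sum_congr rfl fun y hy => ?_
  rw [hcode x hx, hcode y hy]
  rfl

/-- The factor 1/4 comes from listing each of the two unlabelled pairs in both orders. -/
lemma sum_quadratic_one :
    ∑ f : Fin 1 ↪ Fin n, flagVector ((5 + 1) / 2) (GraphFlag.ofInjection G f) ⬝ᵥ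
      (certMatrix (G.comap f) *ᵥ flagVector ((5 + 1) / 2) (GraphFlag.ofInjection G f)) =
    ∑ p ∈ rootIndices n, (rootPart (boolAdj (G.comap (rootMap p))) : ℝ) / 4 / certDen := by
  rw [rootIndices, Finset.sum_sigma]
  refine Finset.sum_congr rfl fun f _ => ?_
  rw [Finset.sum_product, certMatrix_one]
  refine (flagVector_quadratic (s := 3) (GraphFlag.ofInjection G f) (by decide)
    (fun a b => (weightForm certOne a b : ℝ) / certDen)
    (fun A => A.rep.pairCode)
    (fun X => ((GraphFlag.ofInjection G f).restrict (X : Set (Fin n))).pairCode)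
    (fun A X _ h => h.pairCode_eq)).trans ?_
  have hcode : ∀ p ∈ (Finset.univ.erase (f 0)).offDiag,
      ((GraphFlag.ofInjection G f).restrict
        (({p.1, p.2} : Finset (Fin n)) : Set (Fin n))).pairCode =
        (boolAdj G p.1 (f 0) || boolAdj G p.2 (f 0), !boolAdj G p.1 (f 0) || !boolAdj G p.2 (f 0),
          boolAdj G p.1 p.2) := by
    rintro ⟨x, y⟩ hp
    simp only [Finset.mem_offDiag, Finset.mem_erase, Finset.mem_univ, and_true] at hp
    have hroot : ∀ i, (GraphFlag.ofInjection G f).root i = f 0 := fun i => by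
      rw [Subsingleton.elim i 0]; rfl
    have hgraph : (GraphFlag.ofInjection G f).graph = G := rfl
    have hc := G.adj_comm x y
    rw [GraphFlag.pairCode_restrict]
    · refine Prod.ext (decide_eq_of_iff ?_)
        (Prod.ext (decide_eq_of_iff ?_) (decide_eq_of_iff ?_)) <;>
      simp [hroot, hgraph, boolAdj, hc]
    · intro i
      rw [hroot]
      simp [hp.1.symm, hp.2.1.symm]
  have hroot : (GraphFlag.ofInjection G f).root 0 = f 0 := rfl
  rw [GraphFlag.sum_freeSets_three, Finset.sum_div, hroot]
  refine Finset.sum_congr rfl fun p hp => ?_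
  rw [GraphFlag.sum_freeSets_three, Finset.sum_div, Finset.sum_div, hroot]
  refine Finset.sum_congr rfl fun p' hp' => ?_
  rw [hcode p hp, hcode p' hp']
  have : weightForm certOne
      (boolAdj G p.1 (f 0) || boolAdj G p.2 (f 0), !boolAdj G p.1 (f 0) || !boolAdj G p.2 (f 0),
        boolAdj G p.1 p.2)
      (boolAdj G p'.1 (f 0) || boolAdj G p'.2 (f 0),
        !boolAdj G p'.1 (f 0) || !boolAdj G p'.2 (f 0), boolAdj G p'.1 p'.2) =
      rootPart (boolAdj (G.comap (rootMap ⟨f, p, p'⟩))) := rfl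
  rw [this]
  ring

end

lemma exists_bound {α : Type*} [Finite α] (w : α → ℝ) : ∃ b, 0 ≤ b ∧ ∀ a, |w a| ≤ b := by
  cases nonempty_fintype α
  exact ⟨∑ a, |w a|, Finset.sum_nonneg fun _ _ => abs_nonneg _,
    fun a => Finset.single_le_sum (f := fun a => |w a|) (fun _ _ => abs_nonneg _)
      (Finset.mem_univ a)⟩

/-- The slack coefficients of the certificate. -/
def certSlack (H : GraphClass 5) : ℝ :=
  15625 / 62208 - indDensity fourCyclePendant H.rep -
    ∑ π : Equiv.Perm (Fin 5), flagPart (H.rep.comap π)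

/-- By the choice of the slacks the identity is exact when the quadratic forms are replaced by the
sum over embeddings. -/
lemma sum_certSlack {n : ℕ} (G : SimpleGraph (Fin n)) :
    ∑ H : GraphClass 5, (15625 / 62208 - indDensity fourCyclePendant H.rep) *
        (indCount H.rep G : ℝ) - ∑ H : GraphClass 5, certSlack H * (indCount H.rep G : ℝ) =
      ∑ φ : Fin 5 ↪ Fin n, flagPart (G.comap φ) := by
  rw [sum_comap_embedding, ← Finset.sum_sub_distrib]
  refine Finset.sum_congr rfl fun H _ => ?_
  rw [certSlack]
  ring

/-- The error comes only from pairs of flags that overlap outside the roots. It is uniform in the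
graph because the weights take finitely many values on the graphs on `Fin 5`. -/
lemma exists_identity_bound : ∃ C : ℝ, ∀ (n : ℕ) (G : SimpleGraph (Fin n)),
    |∑ φ : Fin 5 ↪ Fin n, flagPart (G.comap φ) -
      ((∑ p ∈ rootIndices n, (rootPart (boolAdj (G.comap (rootMap p))) : ℝ) / 4 / certDen) +
        ∑ p ∈ tripleIndices n, (triplePart (boolAdj (G.comap (tripleMap p))) : ℝ) / certDen)| ≤
      C * (n : ℝ) ^ 4 := by
  obtain ⟨b₁, hb₁, h₁⟩ := exists_bound fun K : SimpleGraph (Fin 5) =>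
    (rootPart (boolAdj K) : ℝ) / 4 / certDen
  obtain ⟨b₃, hb₃, h₃⟩ := exists_bound fun K : SimpleGraph (Fin 5) =>
    (triplePart (boolAdj K) : ℝ) / certDen
  refine ⟨10 * b₁ + 10 * b₃, fun n G => ?_⟩
  have e₁ := abs_sum_sub_sum_embedding_le (rootIndices n) rootMap rootMap_injective.injOn
    exists_rootMap_eq (fun g => (rootPart (boolAdj (G.comap g)) : ℝ) / 4 / certDen) hb₁
    (fun g => h₁ _)
  have e₃ := abs_sum_sub_sum_embedding_le (tripleIndices n) tripleMap tripleMap_injective.injOn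
    exists_tripleMap_eq (fun g => (triplePart (boolAdj (G.comap g)) : ℝ) / certDen) hb₃
    (fun g => h₃ _)
  have hsplit : ∑ φ : Fin 5 ↪ Fin n, flagPart (G.comap φ) =
      ∑ φ : Fin 5 ↪ Fin n, (rootPart (boolAdj (G.comap φ)) : ℝ) / 4 / certDen +
        ∑ φ : Fin 5 ↪ Fin n, (triplePart (boolAdj (G.comap φ)) : ℝ) / certDen := by
    rw [← Finset.sum_add_distrib]
    exact Finset.sum_congr rfl fun φ _ => by rw [flagPart, add_div]
  rw [hsplit]
  rw [abs_le] at e₁ e₃ ⊢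
  constructor <;> nlinarith [e₁.1, e₁.2, e₃.1, e₃.2]

/-- The flag algebra certificate. -/
def certificate : FlagCertificate fourCyclePendant 5 ((5 : ℝ) ^ 6 / (2 ^ 8 * 3 ^ 5)) where
  le_order := le_rfl
  X := certMatrix
  posSemidef := certMatrix_posSemidef
  one_representative := certMatrix_one_representative
  slack := certSlack
  slack_nonneg H := slack_nonneg H.rep
  identity := by
    obtain ⟨C, hC⟩ := exists_identity_bound
    refine ⟨C, fun n G => ?_⟩
    have hu : (5 : ℝ) ^ 6 / (2 ^ 8 * 3 ^ 5) = 15625 / 62208 := by norm_num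
    have hq : (Finset.Icc 1 (5 - 2)).filter (fun q => Even (q + 5)) = {1, 3} := by decide
    rw [hu, hq, Finset.sum_pair (by decide), sum_quadratic_one, sum_quadratic_three]
    refine le_of_eq_of_le ?_ (hC n G)
    rw [← sum_certSlack]
    congr 1
    change _ - (_ + ∑ H : GraphClass 5, certSlack H * (indCount H.rep G : ℝ)) = _
    rw [sub_add_eq_sub_sub_swap]
    rfl

/-! ### The upper bound -/

lemma sum_quadratic_nonneg {n q : ℕ} (G : SimpleGraph (Fin n)) (h1 : 1 ≤ q) (h2 : q + 2 ≤ 5)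
    (h3 : Even (q + 5)) :
    0 ≤ ∑ f : Fin q ↪ Fin n, flagVector ((5 + q) / 2) (GraphFlag.ofInjection G f) ⬝ᵥ
      (certMatrix (G.comap f) *ᵥ flagVector ((5 + q) / 2) (GraphFlag.ofInjection G f)) :=
  Finset.sum_nonneg fun f _ => by
    simpa using (certMatrix_posSemidef (G.comap f) h1 h2 h3).dotProduct_mulVec_nonneg
      (flagVector ((5 + q) / 2) (GraphFlag.ofInjection G f))

/-- The quadratic forms and the slack terms are non-negative and can be dropped from the identity.
-/
lemma exists_indCount_le : ∃ C : ℝ, ∀ (n : ℕ) (G : SimpleGraph (Fin n)),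
    (indCount fourCyclePendant G : ℝ) ≤ 15625 / 62208 * (n.choose 5 : ℝ) + C * (n : ℝ) ^ 4 := by
  obtain ⟨C, hC⟩ := exists_identity_bound
  refine ⟨C, fun n G => ?_⟩
  have h := hC n G
  have h1 := sum_quadratic_nonneg (q := 1) G (by decide) (by decide) (by decide)
  have h3 := sum_quadratic_nonneg (q := 3) G (by decide) (by decide) (by decide)
  rw [sum_quadratic_one] at h1
  rw [sum_quadratic_three] at h3
  have hs : 0 ≤ ∑ H : GraphClass 5, certSlack H * (indCount H.rep G : ℝ) :=
    Finset.sum_nonneg fun H _ => mul_nonneg (slack_nonneg H.rep) (Nat.cast_nonneg _)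
  rw [← sum_certSlack] at h
  simp_rw [sub_mul] at h
  rw [Finset.sum_sub_distrib, ← Finset.mul_sum, sum_indCount_out, sum_indDensity_mul_indCount] at h
  rw [abs_le] at h
  linarith [h.1]

lemma tendsto_pow_div_choose_five :
    Tendsto (fun n : ℕ => (n : ℝ) ^ 5 / (n.choose 5 : ℝ)) atTop (𝓝 120) := by
  have h1 : Tendsto (fun n : ℕ => (n.descFactorial 5 : ℝ) / (n : ℝ) ^ 5) atTop (𝓝 1) := by
    refine tendsto_of_tendsto_of_tendsto_of_le_of_le' (g := fun n : ℕ => 1 - 10 / (n : ℝ))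
      (h := fun _ => 1) ?_ tendsto_const_nhds ?_ ?_
    · simpa using (tendsto_const_div_atTop_nhds_zero_nat (10 : ℝ)).const_sub 1
    · filter_upwards [eventually_gt_atTop 0] with n hn
      have hn' : (0 : ℝ) < n := by exact_mod_cast hn
      rw [le_div_iff₀ (by positivity)]
      have := pow_five_sub_descFactorial_le n
      have e : (1 - 10 / (n : ℝ)) * (n : ℝ) ^ 5 = (n : ℝ) ^ 5 - 10 * (n : ℝ) ^ 4 := by
        field_simp
      rw [e]
      linarith
    · filter_upwards [eventually_gt_atTop 0] with n hn
      have hn' : (0 : ℝ) < n := by exact_mod_cast hn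
      rw [div_le_one (by positivity)]
      exact_mod_cast Nat.descFactorial_le_pow n 5
  have h2 := (h1.inv₀ one_ne_zero).const_mul 120
  rw [inv_one, mul_one] at h2
  refine h2.congr fun n => ?_
  rw [Nat.descFactorial_eq_factorial_mul_choose]
  simp only [Nat.factorial]
  push_cast
  rw [inv_div]
  by_cases h : (n.choose 5 : ℝ) = 0
  · simp [h]
  · field_simp

lemma tendsto_pow_four_div_choose_five :
    Tendsto (fun n : ℕ => (n : ℝ) ^ 4 / (n.choose 5 : ℝ)) atTop (𝓝 0) := by
  have h := tendsto_pow_div_choose_five.mul (tendsto_const_div_atTop_nhds_zero_nat (1 : ℝ))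
  rw [mul_zero] at h
  refine h.congr' ?_
  filter_upwards [eventually_gt_atTop 0] with n hn
  have hn' : (n : ℝ) ≠ 0 := by exact_mod_cast hn.ne'
  field_simp

lemma bddAbove_indDensity {κ : ℕ} (F : SimpleGraph (Fin κ)) (n : ℕ) :
    BddAbove (Set.range fun G : SimpleGraph (Fin n) => indDensity F G) :=
  Set.Finite.bddAbove (Set.finite_range _)

lemma exists_maxIndDensity_le : ∃ C : ℝ, ∀ n : ℕ, 5 ≤ n →
    maxIndDensity fourCyclePendant n ≤
      15625 / 62208 + C * ((n : ℝ) ^ 4 / (n.choose 5 : ℝ)) := by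
  obtain ⟨C, hC⟩ := exists_indCount_le
  refine ⟨C, fun n hn => ciSup_le fun G => ?_⟩
  have hpos : (0 : ℝ) < (n.choose 5 : ℝ) := by exact_mod_cast Nat.choose_pos hn
  rw [indDensity, div_le_iff₀ hpos]
  refine (hC n G).trans (le_of_eq ?_)
  field_simp

/-! ### Monotonicity of the maximum induced density -/

lemma nonempty_iso_induce_map_iff {κ n N : ℕ} (F : SimpleGraph (Fin κ)) (G : SimpleGraph (Fin N))
    (f : Fin n ↪ Fin N) (Y : Finset (Fin n)) :
    Nonempty (F ≃g (G.comap f).induce (Y : Set (Fin n))) ↔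
      Nonempty (F ≃g G.induce ((Y.map f : Finset (Fin N)) : Set (Fin N))) := by
  rw [Finset.coe_map]
  have e : (G.comap f).induce (Y : Set (Fin n)) ≃g G.induce (f '' (Y : Set (Fin n))) :=
    { toEquiv := Equiv.Set.image f _ f.injective
      map_rel_iff' := Iff.rfl }
  exact ⟨fun ⟨g⟩ => ⟨g.trans e⟩, fun ⟨g⟩ => ⟨g.trans e.symm⟩⟩

open Classical in
lemma indCount_comap_succAbove {κ n : ℕ} (F : SimpleGraph (Fin κ)) (G : SimpleGraph (Fin (n + 1)))
    (v : Fin (n + 1)) :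
    indCount F (G.comap v.succAboveEmb) =
      (Finset.univ.filter fun X : Finset (Fin (n + 1)) => (X.card = κ ∧
        Nonempty (F ≃g G.induce (X : Set (Fin (n + 1))))) ∧ v ∉ X).card := by
  rw [indCount, Nat.card_eq_fintype_card, Fintype.card_subtype]
  rw [← Finset.card_map ⟨fun Y : Finset (Fin n) => Y.map v.succAboveEmb,
    Finset.map_injective _⟩]
  congr 1
  ext X
  simp only [Finset.mem_map, Finset.mem_filter, Finset.mem_univ, true_and,
    Function.Embedding.coeFn_mk]
  constructor
  · rintro ⟨Y, ⟨hc, hY⟩, rfl⟩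
    refine ⟨⟨by rw [Finset.card_map, hc], (nonempty_iso_induce_map_iff F G _ Y).1 hY⟩, ?_⟩
    simp [Fin.succAbove_ne]
  · rintro ⟨⟨hc, hX⟩, hv⟩
    obtain ⟨Y, rfl⟩ : ∃ Y : Finset (Fin n), Y.map v.succAboveEmb = X := by
      refine ⟨Finset.univ.filter fun y => v.succAbove y ∈ X, ?_⟩
      ext x
      simp only [Finset.mem_map, Finset.mem_filter, Finset.mem_univ, true_and,
        Fin.succAboveEmb_apply]
      constructor
      · rintro ⟨y, hy, rfl⟩
        exact hy
      · intro hx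
        obtain ⟨y, rfl⟩ := Fin.exists_succAbove_eq (show x ≠ v from fun h => hv (h ▸ hx))
        exact ⟨y, hx, rfl⟩
    rw [Finset.card_map] at hc
    exact ⟨Y, ⟨hc, (nonempty_iso_induce_map_iff F G _ Y).2 hX⟩, rfl⟩

/-- Double counting: a `κ`-set survives the deletion of each of the `n + 1 - κ` vertices outside it.
-/
lemma sum_indCount_comap_succAbove {κ n : ℕ} (F : SimpleGraph (Fin κ))
    (G : SimpleGraph (Fin (n + 1))) :
    ∑ v : Fin (n + 1), indCount F (G.comap v.succAboveEmb) = (n + 1 - κ) * indCount F G := by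
  classical
  have h : ∀ v : Fin (n + 1), indCount F (G.comap v.succAboveEmb) =
      ∑ X ∈ Finset.univ.filter fun X : Finset (Fin (n + 1)) => X.card = κ ∧
        Nonempty (F ≃g G.induce (X : Set (Fin (n + 1)))), if v ∉ X then 1 else 0 := fun v => by
    rw [indCount_comap_succAbove, ← Finset.filter_filter, Finset.card_filter _ (Finset.filter _ _)]
  simp_rw [h]
  rw [indCount, Nat.card_eq_fintype_card, Fintype.card_subtype, Finset.sum_comm, mul_comm]
  refine Finset.sum_const_nat fun X hX => ?_
  rw [Finset.mem_filter] at hX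
  rw [← Finset.card_filter]
  have : (Finset.univ.filter fun v => v ∉ X) = Xᶜ := by ext; simp
  rw [this, Finset.card_compl, hX.2.1, Fintype.card_fin]

/-- The density in a graph is the average of the densities in its vertex-deleted subgraphs. -/
lemma maxIndDensity_succ_le {κ n : ℕ} (F : SimpleGraph (Fin κ)) (hκ : κ ≤ n) :
    maxIndDensity F (n + 1) ≤ maxIndDensity F n := by
  refine ciSup_le fun G => ?_
  have hpos : (0 : ℝ) < (n.choose κ : ℝ) := by exact_mod_cast Nat.choose_pos hκ
  have hpos' : (0 : ℝ) < ((n + 1).choose κ : ℝ) := by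
    exact_mod_cast Nat.choose_pos (hκ.trans n.le_succ)
  have hle : ∀ v : Fin (n + 1), (indCount F (G.comap v.succAboveEmb) : ℝ) ≤
      maxIndDensity F n * (n.choose κ : ℝ) := by
    intro v
    rw [← div_le_iff₀ hpos]
    exact le_ciSup (bddAbove_indDensity F n) _
  have hsum := Finset.sum_le_sum fun v (_ : v ∈ Finset.univ) => hle v
  have hcast : ∑ v : Fin (n + 1), (indCount F (G.comap v.succAboveEmb) : ℝ) =
      ((n + 1 - κ : ℕ) : ℝ) * indCount F G := by
    exact_mod_cast sum_indCount_comap_succAbove F G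
  have hchoose : ((n + 1 : ℕ) : ℝ) * (n.choose κ : ℝ) =
      ((n + 1).choose κ : ℝ) * ((n + 1 - κ : ℕ) : ℝ) := by
    rw [mul_comm]
    exact_mod_cast Nat.choose_mul_succ_eq n κ
  have hk : (0 : ℝ) < ((n + 1 - κ : ℕ) : ℝ) := by
    exact_mod_cast Nat.sub_pos_of_lt (Nat.lt_succ_of_le hκ)
  rw [hcast, Finset.sum_const, Finset.card_univ, Fintype.card_fin, nsmul_eq_mul] at hsum
  rw [indDensity, div_le_iff₀ hpos']
  refine le_of_mul_le_mul_left (hsum.trans (le_of_eq ?_)) hk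
  linear_combination (maxIndDensity F n) * hchoose

/-- If graphs of arbitrarily large order attain the upper bound in the limit, then it is the
inducibility constant. -/
lemma tendsto_maxIndDensity {m : ℕ → ℕ} (hm : Tendsto m atTop atTop)
    (G : ∀ i, SimpleGraph (Fin (m i)))
    (hG : Tendsto (fun i => indDensity fourCyclePendant (G i)) atTop (𝓝 (15625 / 62208))) :
    Tendsto (maxIndDensity fourCyclePendant) atTop (𝓝 (15625 / 62208)) := by
  have hanti : ∀ n N, 5 ≤ n → n ≤ N →
      maxIndDensity fourCyclePendant N ≤ maxIndDensity fourCyclePendant n := by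
    intro n N hn hN
    induction N, hN using Nat.le_induction with
    | base => exact le_rfl
    | succ k hk ih => exact (maxIndDensity_succ_le _ (hn.trans hk)).trans ih
  -- Eventually `G i` has order at least `n`, and then the maximum at `n` dominates its density by
  -- monotonicity.
  have hlower : ∀ n, 5 ≤ n → 15625 / 62208 ≤ maxIndDensity fourCyclePendant n := by
    intro n hn
    refine le_of_tendsto hG ?_
    filter_upwards [hm.eventually_ge_atTop n] with i hi
    exact (le_ciSup (bddAbove_indDensity _ _) (G i)).trans (hanti n (m i) hn hi)
  obtain ⟨C, hC⟩ := exists_maxIndDensity_le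
  have hupper := (tendsto_pow_four_div_choose_five.const_mul C).const_add (15625 / 62208 : ℝ)
  rw [mul_zero, add_zero] at hupper
  refine tendsto_of_tendsto_of_tendsto_of_le_of_le' tendsto_const_nhds hupper ?_ ?_
  · filter_upwards [eventually_ge_atTop 5] with n hn using hlower n hn
  · filter_upwards [eventually_ge_atTop 5] with n hn using hC n hn

/-! ### Induced densities in bipartite quasirandom graphs -/

/-- The number of maps that send the edges in `E` to edges of `G`. -/
def bipHomCount {n : ℕ} (G : SimpleGraph (Fin n)) (V₀ : Finset (Fin n)) {k l : ℕ}
    (E : Finset (Fin k × Fin l)) : ℕ :=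
  Nat.card {p : (Fin k → {x // x ∈ V₀}) × (Fin l → {x // x ∉ V₀}) //
    ∀ e ∈ E, G.Adj (p.1 e.1) (p.2 e.2)}

lemma card_bip_maps {n : ℕ} (V₀ : Finset (Fin n)) (k l : ℕ) :
    Nat.card ((Fin k → {x // x ∈ V₀}) × (Fin l → {x // x ∉ V₀})) =
      V₀.card ^ k * (n - V₀.card) ^ l := by
  have h : Fintype.card {x // x ∉ V₀} = n - V₀.card := by
    rw [Fintype.card_subtype_compl]; simp
  simp [h]

lemma bipHomCount_eq {n : ℕ} (G : SimpleGraph (Fin n)) (V₀ : Finset (Fin n)) {k l : ℕ}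
    (E : Finset (Fin k × Fin l)) :
    (bipHomCount G V₀ E : ℝ) =
      bipHomDensity G V₀ E * ((V₀.card : ℝ) ^ k * ((n : ℝ) - V₀.card) ^ l) := by
  have hn : V₀.card ≤ n := by simpa using Finset.card_le_univ V₀
  have hcard : ((V₀.card : ℝ) ^ k * ((n : ℝ) - V₀.card) ^ l) =
      (Nat.card ((Fin k → {x // x ∈ V₀}) × (Fin l → {x // x ∉ V₀})) : ℝ) := by
    rw [card_bip_maps]
    push_cast [hn]
    rfl
  have hle : bipHomCount G V₀ E ≤
      Nat.card ((Fin k → {x // x ∈ V₀}) × (Fin l → {x // x ∉ V₀})) :=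
    Finite.card_subtype_le _
  rw [hcard]
  -- If there are no maps at all, the density is `0 / 0 = 0`, and the count is zero as well.
  by_cases h0 : Nat.card ((Fin k → {x // x ∈ V₀}) × (Fin l → {x // x ∉ V₀})) = 0
  · rw [h0] at hle ⊢
    simp [Nat.le_zero.1 hle]
  · exact (div_mul_cancel₀ _ (Nat.cast_ne_zero.2 h0)).symm

/-- The map `g` need not be injective: 1 and 3 have the same neighbours and may have the same image.
Such maps are absorbed by the error term later. -/
lemma comap_eq_fourCyclePendant_iff {n : ℕ} (G : SimpleGraph (Fin n)) (g : Fin 5 → Fin n) :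
    G.comap g = fourCyclePendant ↔ G.Adj (g 0) (g 1) ∧ G.Adj (g 1) (g 2) ∧ G.Adj (g 2) (g 3) ∧
      G.Adj (g 0) (g 3) ∧ G.Adj (g 0) (g 4) ∧ ¬ G.Adj (g 0) (g 2) ∧ ¬ G.Adj (g 1) (g 3) ∧
      ¬ G.Adj (g 1) (g 4) ∧ ¬ G.Adj (g 2) (g 4) ∧ ¬ G.Adj (g 3) (g 4) := by
  classical
  have h := isFourCyclePendant_boolAdj (G.comap g)
  rw [Bool.eq_iff_iff, decide_eq_true_iff] at h
  rw [← h]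
  simp [isFourCyclePendant, boolAdj, and_assoc]

section

variable {n : ℕ} {G : SimpleGraph (Fin n)} {V₀ : Finset (Fin n)}

/-- The edges between the vertices `0, 2` and the vertices `1, 3, 4` of the 4-cycle with the
pendant edge. -/
def edgesTwoThree : Finset (Fin 2 × Fin 3) := {(0, 0), (0, 1), (0, 2), (1, 0), (1, 1)}

/-- The edges between the vertices `1, 3, 4` and the vertices `0, 2` of the 4-cycle with the
pendant edge. -/
def edgesThreeTwo : Finset (Fin 3 × Fin 2) := {(0, 0), (1, 0), (2, 0), (0, 1), (1, 1)}

lemma forall_mem_edgesTwoThree {P : Fin 2 × Fin 3 → Prop} : (∀ e ∈ edgesTwoThree, P e) ↔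
    P (0, 0) ∧ P (0, 1) ∧ P (0, 2) ∧ P (1, 0) ∧ P (1, 1) := by
  simp [edgesTwoThree]

lemma forall_mem_edgesThreeTwo {P : Fin 3 × Fin 2 → Prop} : (∀ e ∈ edgesThreeTwo, P e) ↔
    P (0, 0) ∧ P (1, 0) ∧ P (2, 0) ∧ P (0, 1) ∧ P (1, 1) := by
  simp [edgesThreeTwo]

lemma forall_mem_univ_two_three {P : Fin 2 × Fin 3 → Prop} :
    (∀ e ∈ (Finset.univ : Finset (Fin 2 × Fin 3)), P e) ↔
      (∀ e ∈ edgesTwoThree, P e) ∧ P (1, 2) := by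
  rw [forall_mem_edgesTwoThree]
  simp only [Finset.mem_univ, forall_const, Prod.forall, Fin.forall_fin_succ,
    Fin.isValue, IsEmpty.forall_iff, and_true]
  simp
  tauto

lemma forall_mem_univ_three_two {P : Fin 3 × Fin 2 → Prop} :
    (∀ e ∈ (Finset.univ : Finset (Fin 3 × Fin 2)), P e) ↔
      (∀ e ∈ edgesThreeTwo, P e) ∧ P (2, 1) := by
  rw [forall_mem_edgesThreeTwo]
  simp only [Finset.mem_univ, forall_const, Prod.forall, Fin.forall_fin_succ,
    Fin.isValue, IsEmpty.forall_iff, and_true]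
  simp
  tauto

-- Bipartiteness puts 0 and 2 on one side and 1, 3, 4 on the other, and makes every non-edge but 24
-- automatic. So the labelled copies are the maps that preserve the five edges, minus those that
-- also send 24 to an edge.
open Classical in
lemma card_copies_left (hb : ∀ x y, G.Adj x y → (x ∈ V₀ ↔ y ∉ V₀)) :
    (Finset.univ.filter fun g : Fin 5 → Fin n =>
        G.comap g = fourCyclePendant ∧ g 0 ∈ V₀).card +
      bipHomCount G V₀ (Finset.univ : Finset (Fin 2 × Fin 3)) =
      bipHomCount G V₀ edgesTwoThree := by
  rw [bipHomCount, bipHomCount, Nat.card_eq_fintype_card, Nat.card_eq_fintype_card,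
    Fintype.card_subtype, Fintype.card_subtype]
  simp_rw [forall_mem_univ_two_three]
  rw [← Finset.card_filter_add_card_filter_not (s := Finset.univ.filter
      fun p : (Fin 2 → {x // x ∈ V₀}) × (Fin 3 → {x // x ∉ V₀}) =>
        ∀ e ∈ edgesTwoThree, G.Adj (p.1 e.1) (p.2 e.2))
      (fun p => G.Adj (p.1 1) (p.2 2)), Finset.filter_filter, Finset.filter_filter, add_comm]
  congr 1
  symm
  -- The first component holds the images of 0, 2 and the second those of 1, 3, 4.
  refine Finset.card_bij (fun p _ => ![(p.1 0 : Fin n), p.2 0, p.1 1, p.2 1, p.2 2]) ?_ ?_ ?_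
  · rintro ⟨p, r⟩ hp
    simp only [Finset.mem_filter, Finset.mem_univ, true_and, forall_mem_edgesTwoThree] at hp ⊢
    obtain ⟨⟨e1, e2, e3, e4, e5⟩, e6⟩ := hp
    have hp0 := (p 0).2
    have hp1 := (p 1).2
    have hr0 := (r 0).2
    have hr1 := (r 1).2
    have hr2 := (r 2).2
    rw [comap_eq_fourCyclePendant_iff]
    refine ⟨⟨e1, e4.symm, e5, e2, e3, ?_, ?_, ?_, e6, ?_⟩, hp0⟩
    · exact fun h => (hb _ _ h).1 hp0 hp1
    · exact fun h => hr0 ((hb _ _ h).2 hr1)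
    · exact fun h => hr0 ((hb _ _ h).2 hr2)
    · exact fun h => hr1 ((hb _ _ h).2 hr2)
  · rintro ⟨p, r⟩ _ ⟨p', r'⟩ _ h
    have h0 : (p 0 : Fin n) = p' 0 := congrFun h 0
    have h1 : (r 0 : Fin n) = r' 0 := congrFun h 1
    have h2 : (p 1 : Fin n) = p' 1 := congrFun h 2
    have h3 : (r 1 : Fin n) = r' 1 := congrFun h 3
    have h4 : (r 2 : Fin n) = r' 2 := congrFun h 4
    refine Prod.ext (funext fun i => Subtype.ext ?_) (funext fun i => Subtype.ext ?_)
    · fin_cases i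
      exacts [h0, h2]
    · fin_cases i
      exacts [h1, h3, h4]
  · intro g hg
    simp only [Finset.mem_filter, Finset.mem_univ, true_and] at hg
    obtain ⟨hg, h0⟩ := hg
    obtain ⟨e1, e2, e3, e4, e5, -, -, -, e6, -⟩ := (comap_eq_fourCyclePendant_iff G g).1 hg
    have h1 := (hb _ _ e1).1 h0
    have h2 := (hb _ _ e2.symm).2 h1
    have h3 := (hb _ _ e4).1 h0
    have h4 := (hb _ _ e5).1 h0
    refine ⟨(![⟨g 0, h0⟩, ⟨g 2, h2⟩], ![⟨g 1, h1⟩, ⟨g 3, h3⟩, ⟨g 4, h4⟩]), ?_, ?_⟩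
    · simp only [Finset.mem_filter, Finset.mem_univ, true_and, forall_mem_edgesTwoThree]
      exact ⟨⟨e1, e4, e5, e2.symm, e3⟩, e6⟩
    · funext i
      fin_cases i <;> rfl

-- The mirror image of `card_copies_left`, with 0 and 2 outside `V₀`.
open Classical in
lemma card_copies_right (hb : ∀ x y, G.Adj x y → (x ∈ V₀ ↔ y ∉ V₀)) :
    (Finset.univ.filter fun g : Fin 5 → Fin n =>
        G.comap g = fourCyclePendant ∧ g 0 ∉ V₀).card +
      bipHomCount G V₀ (Finset.univ : Finset (Fin 3 × Fin 2)) =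
      bipHomCount G V₀ edgesThreeTwo := by
  rw [bipHomCount, bipHomCount, Nat.card_eq_fintype_card, Nat.card_eq_fintype_card,
    Fintype.card_subtype, Fintype.card_subtype]
  simp_rw [forall_mem_univ_three_two]
  rw [← Finset.card_filter_add_card_filter_not (s := Finset.univ.filter
      fun p : (Fin 3 → {x // x ∈ V₀}) × (Fin 2 → {x // x ∉ V₀}) =>
        ∀ e ∈ edgesThreeTwo, G.Adj (p.1 e.1) (p.2 e.2))
      (fun p => G.Adj (p.1 2) (p.2 1)), Finset.filter_filter, Finset.filter_filter, add_comm]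
  congr 1
  symm
  refine Finset.card_bij (fun p _ => ![(p.2 0 : Fin n), p.1 0, p.2 1, p.1 1, p.1 2]) ?_ ?_ ?_
  · rintro ⟨r, p⟩ hp
    simp only [Finset.mem_filter, Finset.mem_univ, true_and, forall_mem_edgesThreeTwo] at hp ⊢
    obtain ⟨⟨e1, e2, e3, e4, e5⟩, e6⟩ := hp
    have hp0 := (p 0).2
    have hp1 := (p 1).2
    have hr0 := (r 0).2
    have hr1 := (r 1).2
    have hr2 := (r 2).2
    rw [comap_eq_fourCyclePendant_iff]
    refine ⟨⟨e1.symm, e4, e5.symm, e2.symm, e3.symm, ?_, ?_, ?_, fun h => e6 h.symm, ?_⟩, hp0⟩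
    · exact fun h => hp0 ((hb _ _ h).2 hp1)
    · exact fun h => (hb _ _ h).1 hr0 hr1
    · exact fun h => (hb _ _ h).1 hr0 hr2
    · exact fun h => (hb _ _ h).1 hr1 hr2
  · rintro ⟨r, p⟩ _ ⟨r', p'⟩ _ h
    have h0 : (p 0 : Fin n) = p' 0 := congrFun h 0
    have h1 : (r 0 : Fin n) = r' 0 := congrFun h 1
    have h2 : (p 1 : Fin n) = p' 1 := congrFun h 2
    have h3 : (r 1 : Fin n) = r' 1 := congrFun h 3
    have h4 : (r 2 : Fin n) = r' 2 := congrFun h 4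
    refine Prod.ext (funext fun i => Subtype.ext ?_) (funext fun i => Subtype.ext ?_)
    · fin_cases i
      exacts [h1, h3, h4]
    · fin_cases i
      exacts [h0, h2]
  · intro g hg
    simp only [Finset.mem_filter, Finset.mem_univ, true_and] at hg
    obtain ⟨hg, h0⟩ := hg
    obtain ⟨e1, e2, e3, e4, e5, -, -, -, e6, -⟩ := (comap_eq_fourCyclePendant_iff G g).1 hg
    have h1 := (hb _ _ e1.symm).2 h0
    have h2 := (hb _ _ e2).1 h1
    have h3 := (hb _ _ e4.symm).2 h0
    have h4 := (hb _ _ e5.symm).2 h0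
    refine ⟨(![⟨g 1, h1⟩, ⟨g 3, h3⟩, ⟨g 4, h4⟩], ![⟨g 0, h0⟩, ⟨g 2, h2⟩]), ?_, ?_⟩
    · simp only [Finset.mem_filter, Finset.mem_univ, true_and, forall_mem_edgesThreeTwo]
      exact ⟨⟨e1.symm, e4.symm, e5.symm, e2, e3.symm⟩, fun h => e6 h.symm⟩
    · funext i
      fin_cases i <;> rfl

end

-- Each induced copy is the image of two labelled ones, by the automorphism exchanging 1 and 3.
open Classical in
lemma two_mul_indCount_eq {n : ℕ} (G : SimpleGraph (Fin n)) :
    2 * (indCount fourCyclePendant G : ℝ) =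
      ∑ φ : Fin 5 ↪ Fin n, if G.comap φ = fourCyclePendant then (1 : ℝ) else 0 := by
  rw [sum_comap_embedding G fun K => if K = fourCyclePendant then (1 : ℝ) else 0]
  simp_rw [sum_perm_eq_fourCyclePendant]
  rw [← sum_indDensity_mul_indCount, Finset.mul_sum]
  exact Finset.sum_congr rfl fun H _ => by ring

/-- In bipartite graphs, the induced count is given by homomorphism densities, up to a small
error. -/
lemma abs_indCount_sub_le {n : ℕ} {G : SimpleGraph (Fin n)} {V₀ : Finset (Fin n)}
    (hb : ∀ x y, G.Adj x y → (x ∈ V₀ ↔ y ∉ V₀)) :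
    |(V₀.card : ℝ) ^ 2 * ((n : ℝ) - V₀.card) ^ 3 *
        (bipHomDensity G V₀ edgesTwoThree -
          bipHomDensity G V₀ (Finset.univ : Finset (Fin 2 × Fin 3))) +
      (V₀.card : ℝ) ^ 3 * ((n : ℝ) - V₀.card) ^ 2 *
        (bipHomDensity G V₀ edgesThreeTwo -
          bipHomDensity G V₀ (Finset.univ : Finset (Fin 3 × Fin 2))) -
      2 * (indCount fourCyclePendant G : ℝ)| ≤ 10 * (n : ℝ) ^ 4 := by
  classical
  have h := abs_sum_sub_sum_embedding_le (Finset.univ : Finset (Fin 5 → Fin n)) id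
    Function.injective_id.injOn (fun φ => ⟨φ, Finset.mem_univ _, rfl⟩)
    (fun g => if G.comap g = fourCyclePendant then (1 : ℝ) else 0) zero_le_one
    (fun g => by split_ifs <;> simp)
  rw [← two_mul_indCount_eq, mul_one] at h
  refine le_of_eq_of_le ?_ h
  congr 2
  have hl := congrArg (Nat.cast : ℕ → ℝ) (card_copies_left hb)
  have hr := congrArg (Nat.cast : ℕ → ℝ) (card_copies_right hb)
  rw [Nat.cast_add, bipHomCount_eq, bipHomCount_eq] at hl hr
  have hsplit : ((Finset.univ.filter fun g : Fin 5 → Fin n =>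
      G.comap g = fourCyclePendant ∧ g 0 ∈ V₀).card : ℝ) +
      ((Finset.univ.filter fun g : Fin 5 → Fin n =>
        G.comap g = fourCyclePendant ∧ g 0 ∉ V₀).card : ℝ) =
      ((Finset.univ.filter fun g : Fin 5 → Fin n => G.comap g = fourCyclePendant).card : ℝ) := by
    rw [← Finset.filter_filter, ← Finset.filter_filter]
    exact_mod_cast Finset.card_filter_add_card_filter_not _
  simp only [id]
  rw [Finset.sum_boole, ← hsplit]
  linarith

/-- Either side may contain the vertices 0 and 2, and each case has limiting probability `(1/2)^5 *
(c^5 - c^6)` with `c = 5/6`. Multiplication by 120 passes from `n ^ 5` to the binomial coefficient,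
and division by 2 removes the automorphism. -/
lemma tendsto_indDensity_of_quasirandom {m : ℕ → ℕ} {G : ∀ i, SimpleGraph (Fin (m i))}
    {V₀ : ∀ i, Finset (Fin (m i))} (h : IsBalancedQuasirandom (5 / 6) m G V₀) :
    Tendsto (fun i => indDensity fourCyclePendant (G i)) atTop (𝓝 (15625 / 62208)) := by
  have hx := h.balanced
  have hy := hx.const_sub 1
  have d1 := (h.density 2 3 edgesTwoThree).sub (h.density 2 3 Finset.univ)
  have d2 := (h.density 3 2 edgesThreeTwo).sub (h.density 3 2 Finset.univ)
  have c1 : edgesTwoThree.card = 5 := by decide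
  have c2 : edgesThreeTwo.card = 5 := by decide
  have c3 : (Finset.univ : Finset (Fin 2 × Fin 3)).card = 6 := by decide
  have c4 : (Finset.univ : Finset (Fin 3 × Fin 2)).card = 6 := by decide
  rw [c1, c3] at d1
  rw [c2, c4] at d2
  have hmain := (((hx.pow 2).mul (hy.pow 3)).mul d1).add (((hx.pow 3).mul (hy.pow 2)).mul d2)
  have herr : Tendsto (fun i => 10 / (m i : ℝ)) atTop (𝓝 0) :=
    (tendsto_const_div_atTop_nhds_zero_nat (10 : ℝ)).comp h.growing
  have hcount : Tendsto (fun i => 2 * (indCount fourCyclePendant (G i) : ℝ) / (m i : ℝ) ^ 5) atTop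
      (𝓝 ((1 / 2) ^ 2 * (1 - 1 / 2) ^ 3 * ((5 / 6) ^ 5 - (5 / 6) ^ 6) +
        (1 / 2) ^ 3 * (1 - 1 / 2) ^ 2 * ((5 / 6) ^ 5 - (5 / 6) ^ 6))) := by
    refine tendsto_of_tendsto_of_dist hmain ?_
    refine squeeze_zero' (Eventually.of_forall fun i => dist_nonneg) ?_ herr
    filter_upwards [h.growing.eventually_gt_atTop 0] with i hi
    have hn : (0 : ℝ) < m i := by exact_mod_cast hi
    have hbound := abs_indCount_sub_le (h.bipartite i)
    have hsub : 1 - ((V₀ i).card : ℝ) / (m i : ℝ) = ((m i : ℝ) - (V₀ i).card) / (m i : ℝ) := by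
      field_simp
    have hpos : (0 : ℝ) < (m i : ℝ) ^ 5 := by positivity
    have hten : 10 / (m i : ℝ) = 10 * (m i : ℝ) ^ 4 / (m i : ℝ) ^ 5 := by
      field_simp
    rw [hten, Real.dist_eq]
    refine le_of_eq_of_le ?_ (div_le_div_of_nonneg_right hbound hpos.le)
    nth_rw 2 [← abs_of_pos hpos]
    rw [← abs_div, hsub]
    congr 1
    field_simp
  have hfinal := (hcount.mul (tendsto_pow_div_choose_five.comp h.growing)).div_const 2
  have hval : ((1 / 2 : ℝ) ^ 2 * (1 - 1 / 2) ^ 3 * ((5 / 6) ^ 5 - (5 / 6) ^ 6) +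
        (1 / 2) ^ 3 * (1 - 1 / 2) ^ 2 * ((5 / 6) ^ 5 - (5 / 6) ^ 6)) * 120 / 2 =
      15625 / 62208 := by norm_num
  rw [hval] at hfinal
  refine hfinal.congr' ?_
  filter_upwards [h.growing.eventually_gt_atTop 0] with i hi
  have hn : (m i : ℝ) ≠ 0 := by exact_mod_cast hi.ne'
  simp only [Function.comp, indDensity]
  field_simp

/-! ### Existence of balanced quasirandom bipartite graphs of density `5 / 6` -/

/-- A part of the layered graph: a layer together with a function on the set of layers. -/
abbrev Layered (r : ℕ) : Type := Fin r × (Fin r → Fin 6)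

/-- The bipartite graph in which a vertex of layer `i` on one side is joined to the vertices on the
other side whose function does not vanish at `i`. -/
def layeredGraph (r : ℕ) : SimpleGraph (Bool × Layered r) where
  Adj x y := (x.1 = false ∧ y.1 = true ∧ y.2.2 x.2.1 ≠ 0) ∨
    (x.1 = true ∧ y.1 = false ∧ x.2.2 y.2.1 ≠ 0)
  symm := ⟨fun x y h => by tauto⟩
  loopless := ⟨fun x h => by
    rcases h with h | h
    · exact absurd (h.1.symm.trans h.2.1) (by decide)
    · exact absurd (h.1.symm.trans h.2.1) (by decide)⟩

/-- The order of the layered graph. -/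
def layeredOrder (r : ℕ) : ℕ := 2 * (r * 6 ^ r)

/-- An enumeration of the vertices of the layered graph. -/
def layeredEquiv (r : ℕ) : Bool × Layered r ≃ Fin (layeredOrder r) :=
  Fintype.equivFinOfCardEq (by simp [layeredOrder])

/-- The layered graph on the standard vertex set. -/
def layeredFinGraph (r : ℕ) : SimpleGraph (Fin (layeredOrder r)) :=
  (layeredGraph r).comap (layeredEquiv r).symm

/-- One part of the layered graph. -/
def layeredPart (r : ℕ) : Finset (Fin (layeredOrder r)) :=
  Finset.univ.filter fun x => ((layeredEquiv r).symm x).1 = false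

lemma mem_layeredPart {r : ℕ} {x : Fin (layeredOrder r)} :
    x ∈ layeredPart r ↔ ((layeredEquiv r).symm x).1 = false := by
  simp [layeredPart]

/-- The vertices of one part. -/
def layeredPartEquiv (r : ℕ) : Layered r ≃ {x // x ∈ layeredPart r} where
  toFun a := ⟨layeredEquiv r (false, a), by simp [mem_layeredPart]⟩
  invFun x := ((layeredEquiv r).symm x).2
  left_inv a := by simp
  right_inv x := by
    have h := mem_layeredPart.1 x.2
    apply Subtype.ext
    simp only
    rw [← h]
    exact (layeredEquiv r).apply_symm_apply x

/-- The vertices of the other part. -/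
def layeredCoPartEquiv (r : ℕ) : Layered r ≃ {x // x ∉ layeredPart r} where
  toFun a := ⟨layeredEquiv r (true, a), by simp [mem_layeredPart]⟩
  invFun x := ((layeredEquiv r).symm x).2
  left_inv a := by simp
  right_inv x := by
    have h := x.2
    rw [mem_layeredPart, Bool.not_eq_false] at h
    apply Subtype.ext
    simp only
    rw [← h]
    exact (layeredEquiv r).apply_symm_apply x

lemma layeredFinGraph_adj_iff {r : ℕ} (a b : Layered r) :
    (layeredFinGraph r).Adj (layeredPartEquiv r a) (layeredCoPartEquiv r b) ↔ b.2 a.1 ≠ 0 := by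
  simp [layeredFinGraph, layeredPartEquiv, layeredCoPartEquiv, layeredGraph]

lemma layeredFinGraph_bipartite {r : ℕ} (x y : Fin (layeredOrder r))
    (h : (layeredFinGraph r).Adj x y) : x ∈ layeredPart r ↔ y ∉ layeredPart r := by
  rw [mem_layeredPart, mem_layeredPart]
  simp only [layeredFinGraph, SimpleGraph.comap_adj, layeredGraph] at h
  rcases h with h | h <;> simp [h.1, h.2.1]

lemma card_layeredPart (r : ℕ) : (layeredPart r).card = r * 6 ^ r := by
  rw [← Fintype.card_coe, ← Fintype.card_congr (layeredPartEquiv r)]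
  simp

/-- The number of maps into one part, given the layers of the other vertices. -/
def layeredCount {r k l : ℕ} (E : Finset (Fin k × Fin l)) (x : Fin k → Fin r) : ℕ :=
  Nat.card {q : Fin l → Layered r // ∀ e ∈ E, (q e.2).2 (x e.1) ≠ 0}

lemma layeredCount_le {r k l : ℕ} (E : Finset (Fin k × Fin l)) (x : Fin k → Fin r) :
    layeredCount E x ≤ (r * 6 ^ r) ^ l := by
  refine (Finite.card_subtype_le _).trans (le_of_eq ?_)
  simp

/-- Coordinates in `T` have five admissible values instead of six. -/
lemma card_nonvanishing {r : ℕ} (T : Finset (Fin r)) :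
    ((Finset.univ.filter fun h : Fin r → Fin 6 => ∀ i ∈ T, h i ≠ 0).card : ℝ) =
      6 ^ r * (5 / 6) ^ T.card := by
  have h : (Finset.univ.filter fun h : Fin r → Fin 6 => ∀ i ∈ T, h i ≠ 0) =
      Fintype.piFinset fun i => if i ∈ T then Finset.univ.erase (0 : Fin 6) else Finset.univ := by
    ext h
    simp only [Finset.mem_filter, Finset.mem_univ, true_and, Fintype.mem_piFinset]
    refine forall_congr' fun i => ?_
    by_cases hi : i ∈ T <;> simp [hi]
  have hprod : ∀ i : Fin r,
      (((if i ∈ T then Finset.univ.erase (0 : Fin 6) else Finset.univ).card : ℕ) : ℝ) =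
        6 * (if i ∈ T then 5 / 6 else 1) := by
    intro i
    by_cases hi : i ∈ T
    · simp [hi]; norm_num
    · simp [hi]
  rw [h, Fintype.card_piFinset]
  push_cast
  simp_rw [hprod]
  rw [Finset.prod_mul_distrib, Finset.prod_ite, Finset.prod_const, Finset.prod_const,
    Finset.prod_const]
  simp

/-- For distinct layers the edge conditions concern distinct values of independent uniform
functions, so the proportion is exactly a power of `5 / 6`. -/
lemma layeredCount_of_injective {r k l : ℕ} (E : Finset (Fin k × Fin l)) {x : Fin k → Fin r}
    (hx : Function.Injective x) :
    (layeredCount E x : ℝ) = (r * 6 ^ r) ^ l * (5 / 6) ^ E.card := by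
  classical
  -- `T j` is the set of layers at which the function of the `j`-th vertex must not vanish; as `x`
  -- is injective, its size is the degree of `j` in `E`.
  let T : Fin l → Finset (Fin r) := fun j => (Finset.univ.filter fun a => (a, j) ∈ E).image x
  have hT : ∀ j, (T j).card = (E.filter fun e => e.2 = j).card := by
    intro j
    rw [Finset.card_image_of_injective _ hx]
    refine Finset.card_bij (fun a _ => (a, j)) ?_ ?_ ?_
    · intro a ha; simpa using ha
    · intro a _ b _ h; exact congrArg Prod.fst h
    · rintro ⟨a, b⟩ h
      simp only [Finset.mem_filter] at h
      obtain ⟨h, rfl⟩ := h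
      exact ⟨a, by simpa using h, rfl⟩
  have hset : (Finset.univ.filter fun q : Fin l → Layered r =>
      ∀ e ∈ E, (q e.2).2 (x e.1) ≠ 0) = Fintype.piFinset fun j =>
        (Finset.univ : Finset (Fin r)) ×ˢ
          Finset.univ.filter fun h : Fin r → Fin 6 => ∀ i ∈ T j, h i ≠ 0 := by
    ext q
    simp only [Finset.mem_filter, Finset.mem_univ, true_and, Fintype.mem_piFinset,
      Finset.mem_product, T, Finset.mem_image, forall_exists_index, and_imp, Prod.forall]
    constructor
    · rintro h j _ a ha rfl
      exact h a j ha
    · intro h a j ha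
      exact h j _ a ha rfl
  rw [layeredCount, Nat.card_eq_fintype_card, Fintype.card_subtype, hset, Fintype.card_piFinset]
  push_cast [Finset.card_product]
  simp_rw [card_nonvanishing, hT]
  rw [Finset.card_eq_sum_card_fiberwise (f := fun e : Fin k × Fin l => e.2) (t := Finset.univ)
    (by simp)]
  rw [← Finset.prod_pow_eq_pow_sum]
  simp_rw [← mul_assoc]
  rw [Finset.prod_mul_distrib, Finset.prod_const]
  simp

/-- Adjacency ignores the functions attached to the vertices of `layeredPart`; their free choice is
the factor in front. They only serve to make the parts equally large. -/
lemma bipHomCount_layered {r k l : ℕ} (E : Finset (Fin k × Fin l)) :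
    bipHomCount (layeredFinGraph r) (layeredPart r) E =
      (6 ^ r) ^ k * ∑ x : Fin k → Fin r, layeredCount E x := by
  classical
  have e : {p : (Fin k → {x // x ∈ layeredPart r}) × (Fin l → {x // x ∉ layeredPart r}) //
        ∀ e ∈ E, (layeredFinGraph r).Adj (p.1 e.1) (p.2 e.2)} ≃
      (Σ p : (Fin k → Fin r) × (Fin k → Fin r → Fin 6),
        {q : Fin l → Layered r // ∀ e ∈ E, (q e.2).2 (p.1 e.1) ≠ 0}) := by
    refine Equiv.trans ?_ (Equiv.subtypeProdEquivSigmaSubtype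
      (fun (p : (Fin k → Fin r) × (Fin k → Fin r → Fin 6)) (q : Fin l → Layered r) =>
        ∀ e ∈ E, (q e.2).2 (p.1 e.1) ≠ 0))
    refine (Equiv.subtypeEquiv (Equiv.prodCongr
      ((Equiv.arrowProdEquivProdArrow (Fin k) (fun _ => Fin r) (fun _ => Fin r → Fin 6)).symm.trans
        (Equiv.arrowCongr (Equiv.refl _) (layeredPartEquiv r)))
      (Equiv.arrowCongr (Equiv.refl _) (layeredCoPartEquiv r))) ?_).symm
    rintro ⟨p, q⟩
    refine forall₂_congr fun e _ => ?_
    exact (layeredFinGraph_adj_iff (p.1 e.1, p.2 e.1) (q e.2)).symm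
  rw [bipHomCount, Nat.card_congr e, Nat.card_sigma, Fintype.sum_prod_type, Finset.mul_sum]
  refine Finset.sum_congr rfl fun x _ => ?_
  change ∑ _ : Fin k → Fin r → Fin 6, layeredCount E x = _
  simp

/-- The density is an average over the choices of layers. Injective choices give the limit exactly,
and the others err by at most 1, so the error is at most the probability that two layers collide. -/
lemma abs_bipHomDensity_layered_sub_le {r k l : ℕ} (hr : 0 < r) (E : Finset (Fin k × Fin l)) :
    |bipHomDensity (layeredFinGraph r) (layeredPart r) E - (5 / 6) ^ E.card| ≤
      1 - (r.descFactorial k : ℝ) / (r : ℝ) ^ k := by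
  classical
  have hr' : (0 : ℝ) < r := by exact_mod_cast hr
  set M : ℝ := (r * 6 ^ r : ℝ) ^ l with hM
  have hMpos : 0 < M := by positivity
  have hdens : bipHomDensity (layeredFinGraph r) (layeredPart r) E =
      (∑ x : Fin k → Fin r, (layeredCount E x : ℝ) / M) / (r : ℝ) ^ k := by
    have h := bipHomCount_eq (layeredFinGraph r) (layeredPart r) E
    rw [bipHomCount_layered, card_layeredPart] at h
    have ho : ((layeredOrder r : ℕ) : ℝ) - ((r * 6 ^ r : ℕ) : ℝ) = r * 6 ^ r := by
      rw [layeredOrder]; push_cast; ring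
    rw [ho] at h
    push_cast at h
    rw [← Finset.sum_div]
    rw [div_div, eq_div_iff (by positivity)]
    have h6 : (0 : ℝ) < (6 ^ r) ^ k := by positivity
    refine mul_left_cancel₀ h6.ne' ?_
    rw [h, hM]
    ring
  have hcard : (∑ _x : Fin k → Fin r, (1 : ℝ)) = (r : ℝ) ^ k := by simp
  have hinj : (Finset.univ.filter fun x : Fin k → Fin r => Function.Injective x).card =
      r.descFactorial k := by
    rw [← Fintype.card_subtype, Fintype.card_congr (Equiv.subtypeInjectiveEquivEmbedding _ _),
      Fintype.card_embedding_eq]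
    simp
  have hsub : bipHomDensity (layeredFinGraph r) (layeredPart r) E - (5 / 6) ^ E.card =
      (∑ x : Fin k → Fin r, ((layeredCount E x : ℝ) / M - (5 / 6) ^ E.card)) / (r : ℝ) ^ k := by
    rw [hdens, Finset.sum_sub_distrib, sub_div, Finset.sum_const, Finset.card_univ]
    congr 1
    simp only [Fintype.card_fun, Fintype.card_fin, nsmul_eq_mul]
    push_cast
    field_simp
  have hrhs : 1 - (r.descFactorial k : ℝ) / (r : ℝ) ^ k =
      (∑ x : Fin k → Fin r, if Function.Injective x then (0 : ℝ) else 1) / (r : ℝ) ^ k := by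
    have : (∑ x : Fin k → Fin r, if Function.Injective x then (0 : ℝ) else 1) =
        (r : ℝ) ^ k - r.descFactorial k := by
      rw [← hcard, ← hinj, Finset.card_filter, Nat.cast_sum, ← Finset.sum_sub_distrib]
      refine Finset.sum_congr rfl fun x _ => ?_
      split_ifs <;> simp
    rw [this, sub_div, div_self (by positivity)]
  rw [hsub, hrhs, abs_div, abs_of_pos (pow_pos hr' k)]
  refine div_le_div_of_nonneg_right ?_ (by positivity)
  refine (Finset.abs_sum_le_sum_abs _ _).trans (Finset.sum_le_sum fun x _ => ?_)
  split_ifs with h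
  · rw [layeredCount_of_injective E h, ← hM, mul_div_cancel_left₀ _ hMpos.ne', sub_self, abs_zero]
  · have h1 : (layeredCount E x : ℝ) / M ≤ 1 := by
      rw [div_le_one hMpos, hM]
      exact_mod_cast layeredCount_le E x
    have h0 : 0 ≤ (layeredCount E x : ℝ) / M := by positivity
    have h2 : ((5 : ℝ) / 6) ^ E.card ≤ 1 := pow_le_one₀ (by norm_num) (by norm_num)
    have h3 : (0 : ℝ) ≤ (5 / 6) ^ E.card := by positivity
    rw [abs_le]
    constructor <;> linarith

lemma strictMono_layeredOrder : StrictMono fun i => layeredOrder (i + 1) := by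
  refine strictMono_nat_of_lt_succ fun i => ?_
  simp only [layeredOrder]
  have : 0 < 6 ^ (i + 1) := by positivity
  rw [pow_succ 6 (i + 1)]
  nlinarith

lemma isBalancedQuasirandom_layered : IsBalancedQuasirandom (5 / 6)
    (fun i => layeredOrder (i + 1)) (fun i => layeredFinGraph (i + 1))
    (fun i => layeredPart (i + 1)) where
  growing := strictMono_layeredOrder.tendsto_atTop
  bipartite i x y h := layeredFinGraph_bipartite x y h
  balanced := by
    -- The shift to `i + 1` makes every order positive, so the ratio is exactly 1/2.
    refine tendsto_const_nhds.congr fun i => ?_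
    rw [card_layeredPart, layeredOrder]
    push_cast
    field_simp
  density k l E := by
    rw [tendsto_iff_dist_tendsto_zero]
    have hlim : Tendsto (fun r : ℕ => 1 - (r.descFactorial k : ℝ) / (r : ℝ) ^ k) atTop (𝓝 0) := by
      have h := (Asymptotics.isEquivalent_iff_tendsto_one (by
        filter_upwards [eventually_gt_atTop 0] with r hr
        have : (0 : ℝ) < r := by exact_mod_cast hr
        exact (pow_pos this k).ne')).1 (isEquivalent_descFactorial k)
      simpa using h.const_sub 1
    refine squeeze_zero (fun i => dist_nonneg) (fun i => ?_) (hlim.comp (tendsto_add_atTop_nat 1))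
    rw [Real.dist_eq]
    exact abs_bipHomDensity_layered_sub_le (Nat.succ_pos i) E

/-! ### The theorem, assembled from the certificate and the layered graphs. -/

theorem theorem3p15 :
    -- the inducibility constant
    Tendsto (maxIndDensity fourCyclePendant) atTop (𝓝 ((5 : ℝ) ^ 6 / (2 ^ 8 * 3 ^ 5))) ∧
    (5 : ℝ) ^ 6 / (2 ^ 8 * 3 ^ 5) = 15625 / 62208 ∧
    -- it is attained by balanced bipartite quasirandom graphs, which exist
    (∀ (m : ℕ → ℕ) (G : ∀ i, SimpleGraph (Fin (m i))) (V₀ : ∀ i, Finset (Fin (m i))),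
      IsBalancedQuasirandom (5 / 6) m G V₀ →
      Tendsto (fun i => indDensity fourCyclePendant (G i)) atTop
        (𝓝 ((5 : ℝ) ^ 6 / (2 ^ 8 * 3 ^ 5)))) ∧
    (∃ (m : ℕ → ℕ) (G : ∀ i, SimpleGraph (Fin (m i))) (V₀ : ∀ i, Finset (Fin (m i))),
      StrictMono m ∧ IsBalancedQuasirandom (5 / 6) m G V₀) ∧
    -- the flag algebra certificate with the properties of its zero eigenspaces
    (∃ cert : FlagCertificate fourCyclePendant 5 ((5 : ℝ) ^ 6 / (2 ^ 8 * 3 ^ 5)),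
      nullDim (cert.X typeOne) = 1 ∧
      nullDim (cert.X typeCherry) = 1 ∧
      NoSparseNullVector (cert.X typeEmpty) ∧
      NoSparseNullVector (cert.X typeEdge)) := by
  have hu : (5 : ℝ) ^ 6 / (2 ^ 8 * 3 ^ 5) = 15625 / 62208 := by norm_num
  refine ⟨?_, hu, ?_, ?_, ?_⟩
  · rw [hu]
    exact tendsto_maxIndDensity isBalancedQuasirandom_layered.growing _
      (tendsto_indDensity_of_quasirandom isBalancedQuasirandom_layered)
  · intro m G V₀ h
    rw [hu]
    exact tendsto_indDensity_of_quasirandom h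
  · exact ⟨_, _, _, strictMono_layeredOrder, isBalancedQuasirandom_layered⟩
  · exact ⟨certificate, nullDim_certMatrix_typeOne, nullDim_certMatrix_typeCherry,
      noSparseNullVector_typeEmpty, noSparseNullVector_typeEdge⟩

end
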